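/- Let $G$ be a discrete group. For an integer $d\geq 2$, let $M_d(G)$ denote the set of all bounded functions $\varphi:G\to\mathbb{C}$ for which there are complex Hilbert spaces $\mathcal{H}_0,\mathcal{H}_1,\ldots,\mathcal{H}_d$ with $\mathcal{H}_0=\mathcal{H}_d=\mathbb{C}$ and bounded maps $\xi_i:G\to\mathbf{B}(\mathcal{H}_i,\mathcal{H}_{i-1})$ ($i=1,\ldots,d$) into the bounded linear operators from $\mathcal{H}_i$ to $\mathcal{H}_{i-1}$ such that \[ \varphi(t_1\cdots t_d)=\xi_1(t_1)\cdots\xi_d(t_d)1\qquad\text{for all } t_1,\ldots,t_d\in G. \] If $G$ contains a nonabelian free subgroup, then, for every integer $d\geq 2$, \[ M_{d+1}(G)\subsetneq M_d(G). \] -/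

import Mathlib

open scoped BoundedContinuousFunction

universe u

namespace MdMultiplier

/-- For spaces `H 0, H 1, H 2, …` and operator-valued maps `ξ i : G → B(H (i+1), H i)`, the
composite `ξ 0 (t 0) ∘ ξ 1 (t 1) ∘ ⋯ ∘ ξ (d-1) (t (d-1)) : H d → H 0`. The map called `ξ i` here
is the one usually called `ξ_{i+1}`. -/
noncomputable def chainProd {G : Type u} (H : ℕ → Type u) [∀ i, NormedAddCommGroup (H i)]
    [∀ i, InnerProductSpace ℂ (H i)] (ξ : ∀ i : ℕ, G → (H (i + 1) →L[ℂ] H i)) :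
    (d : ℕ) → (Fin d → G) → (H d →L[ℂ] H 0)
  | 0, _ => ContinuousLinearMap.id ℂ (H 0)
  | d + 1, t => (chainProd H ξ d (fun i => t i.castSucc)).comp (ξ d (t (Fin.last d)))

/-- A decomposition `φ (t₁ ⋯ t_d) = ξ₁(t₁) ⋯ ξ_d(t_d) 1` through Hilbert spaces
`H 0, …, H d`, with bounded maps `ξ`. The spaces `H 0` and `H d` are copies of `ℂ`, identified
with `ℂ` by the linear isometries `e₀` and `e`. The families are indexed by `ℕ` for convenience:
only `H i` for `i ≤ d` and `ξ i` for `i < d` play a role.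
The Hilbert spaces live in the universe of `G`, which is no restriction: `H i` may always be
replaced by the closed span of the vectors `ξ_{i+1}(t_{i+1}) ⋯ ξ_d(t_d) 1`, a Hilbert space of
density character at most `max |G| ℵ₀`. -/
structure Decomposition {G : Type u} [Group G] (d : ℕ) (φ : G → ℂ) where
  H : ℕ → Type u
  [normed : ∀ i, NormedAddCommGroup (H i)]
  [inner : ∀ i, InnerProductSpace ℂ (H i)]
  [complete : ∀ i, CompleteSpace (H i)]
  e₀ : H 0 ≃ₗᵢ[ℂ] ℂ
  e : H d ≃ₗᵢ[ℂ] ℂ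
  ξ : ∀ i : ℕ, G → (H (i + 1) →L[ℂ] H i)
  bounded : ∀ i < d, ∃ C : ℝ, ∀ t : G, ‖ξ i t‖ ≤ C
  eq_chainProd : ∀ t : Fin d → G, φ (List.ofFn t).prod = e₀ (chainProd H ξ d t (e.symm 1))

end MdMultiplier

/-- The set `M_d(G)` of `M_d`-multipliers of `G`, for `d ≥ 2`: the bounded continuous functions
`φ : G → ℂ` that have a decomposition `φ (t₁ ⋯ t_d) = ξ₁(t₁) ⋯ ξ_d(t_d) 1`. -/
def MdMultipliers (G : Type u) [Group G] [TopologicalSpace G] (d : ℕ) : Set (G →ᵇ ℂ) :=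
  {φ | Nonempty (MdMultiplier.Decomposition d (φ : G → ℂ))}

/-! Suppose that on all words of length m in N letters, indexed by `ZMod N`, φ equals r times a
product of Fourier phases χ(ij) of consecutive letters. If φ has a decomposition of length m,
summing φ against the conjugate phases amounts to m Fourier transforms interleaved with the bounded
maps ξ. Each stage has norm O(√N), the initial vector has square norm N and the sum is N^m r; hence
r² N^(m-1) ≤ C with C independent of N (`Decomposition.exists_bound`).

For d = n + 1, a function in M_d is built that violates this bound for m = n + 2. Let T remove a
positive first letter with half a Fourier phase as weight. Then (1 - T)⁻¹ applied to a base vector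
has the required phases on positive words. Put π(t) = (1 - T) λ(t) (1 - T)⁻¹ with λ right
translation. The commutator of λ(t) and T lives only where x and xt have different first letters.
Ping-pong confines it to a path on which (1 - T)⁻¹ is controlled by a geometric series, so N^(-1/2)
π(t) is bounded uniformly in t and N (`energy_scale_rep_le`).

The scaling S by N^(-1/2) commutes with all these operators. So φ(t) = f_t(S^n w), with f_t
evaluating (1 - T)⁻¹ at t, factors over t₁⋯t_{n+1} as f_{t₁} followed by the n bounded maps Sπ(t_j),
applied to w (`nonempty_decomposition_of_scaled_rep`). Thus r is of order N^(-n/2), whereas a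
decomposition of length n + 2 would force N^(-(n+1)/2). All sizes N = 64^k are handled at once with
summable coefficients; the resulting loss 4^k is less than √N = 8^k. -/

/-! ### Ping-pong and first letters -/

/-- A "first letter" map on a group `G` with respect to elements `gen i`: this is ping-pong data
for the action of `G` on itself by left translations, with base point `1`. -/
structure FirstLetter (G : Type*) [Group G] (I : Type*) where
  gen : I → G
  fst : G → Option (I × Bool)
  fst_one : fst 1 = none
  fst_gen_mul : ∀ i y, fst y ≠ some (i, false) → fst (gen i * y) = some (i, true)
  fst_inv_mul : ∀ i y, fst y ≠ some (i, true) → fst ((gen i)⁻¹ * y) = some (i, false)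

namespace FirstLetter

/-- The first letter of the reduced word of an element of a free group. -/
noncomputable def ofFreeGroup (X : Type*) [DecidableEq X] : FirstLetter (FreeGroup X) X where
  gen := FreeGroup.of
  fst y := y.toWord.head?
  fst_one := by simp
  fst_gen_mul i y h := by
    rw [FreeGroup.toWord_mul, FreeGroup.toWord_of, List.singleton_append, FreeGroup.reduce.cons,
      FreeGroup.reduce_toWord]
    cases hy : y.toWord with
    | nil => rfl
    | cons p l =>
      rw [hy] at h
      have : ¬ (i = p.1 ∧ true = !p.2) := by
        rintro ⟨h1, h2⟩
        apply h
        obtain ⟨p1, p2⟩ := p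
        subst h1
        cases p2
        · rfl
        · exact absurd h2 (by simp)
      simp only [if_neg this]
      rfl
  fst_inv_mul i y h := by
    rw [FreeGroup.toWord_mul, FreeGroup.toWord_inv, FreeGroup.toWord_of]
    have : FreeGroup.invRev [(i, true)] = [(i, false)] := rfl
    rw [this, List.singleton_append, FreeGroup.reduce.cons, FreeGroup.reduce_toWord]
    cases hy : y.toWord with
    | nil => rfl
    | cons p l =>
      rw [hy] at h
      have : ¬ (i = p.1 ∧ false = !p.2) := by
        rintro ⟨h1, h2⟩
        apply h
        obtain ⟨p1, p2⟩ := p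
        subst h1
        cases p2
        · exact absurd h2 (by simp)
        · rfl
      simp only [if_neg this]
      rfl

variable {G H : Type*} [Group G] [Group H] {I J : Type*}

/-- Transport of a first letter map to an overgroup along an equivariant retraction. -/
def extend (F : FirstLetter H I) (f : H →* G) (r : G → H) (hr : ∀ h y, r (f h * y) = h * r y)
    (hr1 : r 1 = 1) : FirstLetter G I where
  gen i := f (F.gen i)
  fst y := F.fst (r y)
  fst_one := by rw [hr1, F.fst_one]
  fst_gen_mul i y h := by rw [hr]; exact F.fst_gen_mul i _ h
  fst_inv_mul i y h := by rw [← map_inv, hr]; exact F.fst_inv_mul i _ h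

/-- Restriction of a first letter map to a subfamily. -/
noncomputable def restrict (F : FirstLetter G I) (f : J → I) (hf : Function.Injective f) :
    FirstLetter G J := by
  classical
  have key : ∀ y (p : J × Bool), (if h : ∃ p : J × Bool, F.fst y = some (f p.1, p.2) then
      some h.choose else none) = some p ↔ F.fst y = some (f p.1, p.2) := by
    intro y p
    split_ifs with h
    · have h1 := h.choose_spec
      constructor
      · intro h2
        rw [Option.some.injEq] at h2
        rw [h2] at h1
        exact h1
      · intro h2
        rw [h1] at h2
        simp only [Option.some.injEq, Prod.mk.injEq] at h2
        rw [Option.some.injEq]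
        exact Prod.ext (hf h2.1) h2.2
    · simp only [false_iff]
      intro h2
      exact h ⟨p, h2⟩
  exact {
    gen := fun j => F.gen (f j)
    fst := fun y => if h : ∃ p : J × Bool, F.fst y = some (f p.1, p.2) then
      some h.choose else none
    fst_one := by simp [F.fst_one]
    fst_gen_mul := fun i y h => by
      rw [Ne, key] at h
      rw [key]
      exact F.fst_gen_mul _ _ h
    fst_inv_mul := fun i y h => by
      rw [Ne, key] at h
      rw [key]
      exact F.fst_inv_mul _ _ h }

theorem fst_pow_mul (F : FirstLetter G I) (a : I) (n : ℕ) (y : G)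
    (h : F.fst y ≠ some (a, false)) : F.fst (F.gen a ^ (n + 1) * y) = some (a, true) := by
  induction n with
  | zero => simpa using F.fst_gen_mul a y h
  | succ n ih =>
    rw [pow_succ', mul_assoc]
    exact F.fst_gen_mul a _ (by simp [ih])

theorem fst_inv_pow_mul (F : FirstLetter G I) (a : I) (n : ℕ) (y : G)
    (h : F.fst y ≠ some (a, true)) : F.fst ((F.gen a)⁻¹ ^ (n + 1) * y) = some (a, false) := by
  induction n with
  | zero => simpa using F.fst_inv_mul a y h
  | succ n ih =>
    rw [pow_succ', mul_assoc]
    exact F.fst_inv_mul a _ (by rw [ih]; simp)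

theorem fst_zpow_mul (F : FirstLetter G I) (a : I) (n : ℤ) (hn : n ≠ 0) (y : G)
    (h : ∀ e, F.fst y ≠ some (a, e)) : ∃ e, F.fst (F.gen a ^ n * y) = some (a, e) := by
  obtain ⟨k, rfl | rfl⟩ := n.eq_nat_or_neg
  · obtain ⟨k, rfl⟩ := Nat.exists_eq_succ_of_ne_zero (n := k) (by simpa using hn)
    exact ⟨true, by rw [zpow_natCast]; exact F.fst_pow_mul a k y (h _)⟩
  · obtain ⟨k, rfl⟩ := Nat.exists_eq_succ_of_ne_zero (n := k) (by simpa using hn)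
    exact ⟨false, by rw [zpow_neg, zpow_natCast, ← inv_pow]; exact F.fst_inv_pow_mul a k y (h _)⟩

/-- The first letter map for the free family `aⁿ b a⁻ⁿ`, `n : ℤ`. -/
noncomputable def conjFamily (F : FirstLetter G I) (a b : I) (hab : a ≠ b) : FirstLetter G ℤ := by
  classical
  have uniq : ∀ y (p q : ℤ × Bool), F.fst (F.gen a ^ (-p.1) * y) = some (b, p.2) →
      F.fst (F.gen a ^ (-q.1) * y) = some (b, q.2) → p = q := by
    intro y p q hp hq
    -- If a⁻ᵖy begins with a power of b, every other a⁻𐞥y differs from it by a nontrivial power of a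
    -- on the left, hence begins with a.
    have h1 : p.1 = q.1 := by
      by_contra hne
      obtain ⟨e, he⟩ := F.fst_zpow_mul a (p.1 - q.1) (sub_ne_zero.mpr hne)
        (F.gen a ^ (-p.1) * y) (by intro e; rw [hp]; simp [hab.symm])
      rw [← mul_assoc, ← zpow_add, show p.1 - q.1 + -p.1 = -q.1 by ring, hq] at he
      simp [hab.symm] at he
    refine Prod.ext h1 ?_
    rw [h1, hq] at hp
    simpa using hp.symm
  have key : ∀ y (p : ℤ × Bool),
      (if h : ∃ p : ℤ × Bool, F.fst (F.gen a ^ (-p.1) * y) = some (b, p.2) then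
      some h.choose else none) = some p ↔ F.fst (F.gen a ^ (-p.1) * y) = some (b, p.2) := by
    intro y p
    split_ifs with h
    · rw [Option.some.injEq]
      exact ⟨fun h2 => h2 ▸ h.choose_spec, fun h2 => uniq y _ _ h.choose_spec h2⟩
    · simp only [false_iff]
      intro h2
      exact h ⟨p, h2⟩
  exact {
    gen := fun n => F.gen a ^ n * F.gen b * F.gen a ^ (-n)
    fst := fun y => if h : ∃ p : ℤ × Bool, F.fst (F.gen a ^ (-p.1) * y) = some (b, p.2) then
      some h.choose else none
    fst_one := by
      rw [dif_neg]
      rintro ⟨p, hp⟩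
      by_cases h0 : p.1 = 0
      · simp [h0, F.fst_one] at hp
      · obtain ⟨e, he⟩ := F.fst_zpow_mul a (-p.1) (neg_ne_zero.mpr h0) 1 (by simp [F.fst_one])
        rw [hp] at he
        simp [hab.symm] at he
    fst_gen_mul := fun n y h => by
      rw [Ne, key] at h
      rw [key]
      have : F.gen a ^ (-n) * (F.gen a ^ n * F.gen b * F.gen a ^ (-n) * y)
        = F.gen b * (F.gen a ^ (-n) * y) := by group
      simp only [this]
      exact F.fst_gen_mul _ _ h
    fst_inv_mul := fun n y h => by
      rw [Ne, key] at h
      rw [key]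
      have : F.gen a ^ (-n) * ((F.gen a ^ n * F.gen b * F.gen a ^ (-n))⁻¹ * y)
        = (F.gen b)⁻¹ * (F.gen a ^ (-n) * y) := by group
      simp only [this]
      exact F.fst_inv_mul _ _ h }

end FirstLetter

/-- A subgroup admits a normalized left-equivariant retraction from the whole group. -/
theorem Subgroup.exists_equivariant_retraction {G : Type*} [Group G] (F : Subgroup G) :
    ∃ r : G → F, (∀ (h : F) (y : G), r (h * y) = h * r y) ∧ r 1 = 1 := by
  -- Writing y = r₀(y) σ(y) with σ(y) a representative of the right coset Fy makes r₀ equivariant; a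
  -- right factor r₀(1)⁻¹ normalizes it without affecting this.
  let σ : G → G := fun y => (Quotient.mk (QuotientGroup.rightRel F) y).out
  have hσ : ∀ y, y * (σ y)⁻¹ ∈ F := fun y =>
    QuotientGroup.rightRel_apply.mp (Quotient.exact (Quotient.out_eq
      (Quotient.mk (QuotientGroup.rightRel F) y)))
  have hσm : ∀ (h : F) y, σ (h * y) = σ y := by
    intro h y
    have : Quotient.mk (QuotientGroup.rightRel F) (h * y) =
        Quotient.mk (QuotientGroup.rightRel F) y := by
      apply Quotient.sound
      apply (QuotientGroup.rightRel F).symm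
      apply QuotientGroup.rightRel_apply.mpr
      simp
    simp only [σ, this]
  let r₀ : G → F := fun y => ⟨y * (σ y)⁻¹, hσ y⟩
  have hr₀ : ∀ (h : F) (y : G), r₀ (h * y) = h * r₀ y := by
    intro h y
    ext
    simp [r₀, hσm, mul_assoc]
  exact ⟨fun y => r₀ y * (r₀ 1)⁻¹, fun h y => by simp only [hr₀, mul_assoc], mul_inv_cancel _⟩

theorem FreeGroup.mul_comm_of_subsingleton {X : Type*} [Subsingleton X] (x y : FreeGroup X) :
    x * y = y * x := by
  have hc : ∀ a : X, ∀ z : FreeGroup X, Commute (FreeGroup.of a) z := by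
    intro a z
    induction z using FreeGroup.induction_on with
    | C1 => exact Commute.one_right _
    | of b => rw [Subsingleton.elim a b]
    | inv_of b h => exact h.inv_right
    | mul p q hp hq => exact hp.mul_right hq
  change Commute x y
  induction x using FreeGroup.induction_on with
  | C1 => exact Commute.one_left _
  | of b => exact hc b y
  | inv_of b h => exact h.inv_left
  | mul p q hp hq => exact hp.mul_left hq

/-- A group with a nonabelian free subgroup carries a first letter map for any countable family
of letters. -/
theorem FirstLetter.nonempty_of_free_subgroup {G : Type*} [Group G]
    (hG : ∃ F : Subgroup G, IsFreeGroup F ∧ ∃ a b : F, a * b ≠ b * a) (I : Type*) [Countable I] :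
    Nonempty (FirstLetter G I) := by
  classical
  obtain ⟨F, hF, a, b, hab⟩ := hG
  let e := IsFreeGroup.toFreeGroup F
  have hX : ¬ Subsingleton (IsFreeGroup.Generators F) := by
    intro hs
    apply hab
    apply e.injective
    rw [map_mul, map_mul]
    exact FreeGroup.mul_comm_of_subsingleton _ _
  rw [not_subsingleton_iff_nontrivial] at hX
  obtain ⟨p, q, hpq⟩ := exists_pair_ne (IsFreeGroup.Generators F)
  obtain ⟨r, hr, hr1⟩ := F.exists_equivariant_retraction
  obtain ⟨n, hn⟩ := Countable.exists_injective_nat I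
  let A : FirstLetter G (IsFreeGroup.Generators F) :=
    (FirstLetter.ofFreeGroup (IsFreeGroup.Generators F)).extend
      (F.subtype.comp e.symm.toMonoidHom) (fun y => e (r y))
      (fun h y => by
        change e (r ((e.symm h : F) * y)) = _
        rw [hr, map_mul]; simp)
      (by simp [hr1])
  exact ⟨(A.conjFamily p q hpq).restrict (fun i => (n i : ℤ))
    (fun i j h => hn (Int.ofNat_injective h))⟩

/-! ### Shortening and constructing decompositions -/

namespace MdMultiplier

/-- The index map used to compose the first two maps of a decomposition. -/
def mergeIndex : ℕ → ℕ
  | 0 => 0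
  | i + 1 => i + 2

/-- The maps of a decomposition in which the first two maps are composed, the first one being
evaluated at `1`. -/
noncomputable def mergeMap {G : Type u} [Group G] (H : ℕ → Type u)
    [∀ i, NormedAddCommGroup (H i)] [∀ i, InnerProductSpace ℂ (H i)]
    (ξ : ∀ i : ℕ, G → (H (i + 1) →L[ℂ] H i)) :
    ∀ i : ℕ, G → (H (mergeIndex (i + 1)) →L[ℂ] H (mergeIndex i))
  | 0 => fun t => (ξ 0 1).comp (ξ 1 t)
  | i + 1 => ξ (i + 2)

theorem chainProd_mergeMap {G : Type u} [Group G] (H : ℕ → Type u)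
    [∀ i, NormedAddCommGroup (H i)] [∀ i, InnerProductSpace ℂ (H i)]
    (ξ : ∀ i : ℕ, G → (H (i + 1) →L[ℂ] H i)) (n : ℕ) (t : Fin (n + 1) → G) :
    chainProd (fun i => H (mergeIndex i)) (mergeMap H ξ) (n + 1) t =
      chainProd H ξ (n + 2) (Fin.cons 1 t) := by
  induction n with
  | zero => rfl
  | succ n ih =>
    rw [chainProd, ih]
    conv_rhs => rw [chainProd]
    have h1 : (fun i : Fin (n + 2) => (Fin.cons 1 t : Fin (n + 3) → G) i.castSucc) =
        Fin.cons 1 (fun i : Fin (n + 1) => t i.castSucc) := by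
      funext i
      refine Fin.cases ?_ (fun j => ?_) i <;> rfl
    rw [h1]
    rfl

/-- A decomposition of length `n + 2` gives one of length `n + 1`. -/
theorem Decomposition.nonempty_pred {G : Type u} [Group G] {n : ℕ} {φ : G → ℂ}
    (D : Decomposition (n + 2) φ) : Nonempty (Decomposition (n + 1) φ) := by
  obtain ⟨H, e₀, e, ξ, hb, hξ⟩ := D
  refine ⟨{
    H := fun i => H (mergeIndex i)
    e₀ := e₀
    e := e
    ξ := mergeMap H ξ
    bounded := ?_
    eq_chainProd := ?_ }⟩
  · intro i hi
    cases i with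
    | zero =>
      obtain ⟨C, hC⟩ := hb 0 (by omega)
      obtain ⟨C', hC'⟩ := hb 1 (by omega)
      refine ⟨C * C', fun t => ?_⟩
      exact (ContinuousLinearMap.opNorm_comp_le _ _).trans
        (mul_le_mul (hC 1) (hC' t) (norm_nonneg _) ((norm_nonneg _).trans (hC 1)))
    | succ i => exact hb (i + 2) (by omega)
  · intro t
    rw [chainProd_mergeMap]
    -- Putting 1 in the first slot leaves the product unchanged.
    have := hξ (Fin.cons 1 t)
    rw [List.ofFn_cons, List.prod_cons, one_mul] at this
    exact this

/-- A decomposition from a "scaled representation" `R` on a Hilbert space `E`. -/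
theorem nonempty_decomposition_of_scaled_rep {G : Type u} [Group G] {E : Type u}
    [NormedAddCommGroup E] [InnerProductSpace ℂ E] [CompleteSpace E] (n : ℕ)
    (φ : G → ℂ) (w : E) (hw : w ≠ 0) (f : G → (E →L[ℂ] ℂ)) (R : G → (E →L[ℂ] E)) (S : E →L[ℂ] E)
    (Cf CR : ℝ) (hf : ∀ t, ‖f t‖ ≤ Cf) (hR : ∀ t, ‖R t‖ ≤ CR)
    (hfR : ∀ a b x, f a (R b x) = f (a * b) (S x)) (hSR : ∀ b x, S (R b x) = R b (S x))
    (hφ : ∀ t, φ t = f t ((S ^ n) w)) : Nonempty (Decomposition (n + 1) φ) := by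
  classical
  let v : E := ((‖w‖ : ℂ)⁻¹) • w
  have hw' : (‖w‖ : ℂ) ≠ 0 := by simpa using hw
  have hv : ‖v‖ = 1 := by
    simp only [v, norm_smul, norm_inv, Complex.norm_real, norm_norm]
    exact inv_mul_cancel₀ (norm_ne_zero_iff.mpr hw)
  -- The end spaces must be lines, and both are taken to be the line of w. With all spaces inside E,
  -- the projections in `ξ` only adjust the codomain: they fix every vector that occurs.
  let K : ℕ → Submodule ℂ E := fun i => if i = 0 ∨ i = n + 1 then ℂ ∙ v else ⊤
  have hK0 : K 0 = ℂ ∙ v := by simp [K]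
  have hKn : K (n + 1) = ℂ ∙ v := by simp [K]
  have hKi : ∀ i, i ≠ 0 → i ≤ n → K i = ⊤ := by
    intro i h1 h2
    simp only [K]
    rw [if_neg]
    omega
  have hc : ∀ i, CompleteSpace (K i) := by
    intro i
    by_cases h : i = 0 ∨ i = n + 1
    · have : K i = ℂ ∙ v := if_pos h
      rw [this]
      infer_instance
    · have : K i = ⊤ := if_neg h
      rw [this]
      exact completeSpace_coe_iff_isComplete.mpr isComplete_univ
  -- The factor ‖w‖ compensates for starting at the unit vector v instead of w.
  let Ξ : ℕ → G → (E →L[ℂ] E) := fun i t =>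
    if i = 0 then (((‖w‖ : ℂ)) • f t).smulRight v else R t
  let ξ : ∀ i : ℕ, G → (K (i + 1) →L[ℂ] K i) := fun i t =>
    (K i).orthogonalProjectionOnto.comp ((Ξ i t).comp (K (i + 1)).subtypeL)
  have hξ0 : ∀ t (x : K 1), ((ξ 0 t x : K 0) : E) = ((‖w‖ : ℂ) * f t x) • v := by
    intro t x
    have h1 : ((‖w‖ : ℂ) * f t x) • v ∈ K 0 := by
      rw [hK0]
      exact Submodule.smul_mem _ _ (Submodule.mem_span_singleton_self v)
    have h2 : ξ 0 t x = (K 0).orthogonalProjectionOnto (((‖w‖ : ℂ) * f t x) • v) := by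
      simp [ξ, Ξ]
    rw [h2]
    exact Submodule.starProjection_eq_self_iff.mpr h1
  have hξi : ∀ i, i ≠ 0 → i ≤ n → ∀ t (x : K (i + 1)), ((ξ i t x : K i) : E) = R t x := by
    intro i h0 h1 t x
    have h2 : ξ i t x = (K i).orthogonalProjectionOnto (R t x) := by
      simp [ξ, Ξ, h0]
    rw [h2]
    refine Submodule.starProjection_eq_self_iff.mpr ?_
    rw [hKi i h0 h1]
    trivial
  have hSkR : ∀ k b x, (S ^ k) (R b x) = R b ((S ^ k) x) := by
    intro k b x
    induction k with
    | zero => rfl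
    | succ k ih => rw [pow_succ', mul_apply_eq_comp, ih, hSR]; rfl
  have key : ∀ k, k ≤ n → ∀ (t : Fin (k + 1) → G) (x : K (k + 1)),
      ((chainProd (fun i => K i) ξ (k + 1) t x : K 0) : E) =
        ((‖w‖ : ℂ) * f (List.ofFn t).prod ((S ^ k) x)) • v := by
    intro k
    induction k with
    | zero =>
      intro _ t x
      have : chainProd (fun i => K i) ξ 1 t x = ξ 0 (t (Fin.last 0)) x := rfl
      erw [this, hξ0]
      simp
    | succ k ih =>
      intro hk t x
      have : chainProd (fun i => K i) ξ (k + 2) t x =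
        chainProd (fun i => K i) ξ (k + 1) (fun i => t i.castSucc)
          (ξ (k + 1) (t (Fin.last _)) x) := rfl
      erw [this, ih (by omega), hξi (k + 1) (by omega) hk]
      rw [hSkR, hfR, List.ofFn_succ' t, List.concat_eq_append, List.prod_append,
        List.prod_singleton, pow_succ', mul_apply_eq_comp]
  let e₀ : K 0 ≃ₗᵢ[ℂ] ℂ := (LinearIsometryEquiv.ofEq _ _ hK0).trans
    (LinearIsometryEquiv.toSpanUnitSingleton v hv).symm
  let e : K (n + 1) ≃ₗᵢ[ℂ] ℂ := (LinearIsometryEquiv.ofEq _ _ hKn).trans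
    (LinearIsometryEquiv.toSpanUnitSingleton v hv).symm
  have he : ((e.symm 1 : K (n + 1)) : E) = v := by
    have : ((e.symm 1 : K (n + 1)) : E) = (1 : ℂ) • v := rfl
    rw [this, one_smul]
  have he₀ : ∀ (y : K 0) (c : ℂ), (y : E) = c • v → e₀ y = c := by
    intro y c h
    apply e₀.symm.injective
    rw [LinearIsometryEquiv.symm_apply_apply]
    apply Subtype.ext
    rw [h]
    rfl
  refine ⟨{
    H := fun i => K i
    e₀ := e₀
    e := e
    ξ := ξ
    bounded := ?_
    eq_chainProd := ?_ }⟩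
  · intro i _
    have hΞ : ∃ C, ∀ t, ‖Ξ i t‖ ≤ C := by
      by_cases h : i = 0
      · refine ⟨‖w‖ * Cf, fun t => ?_⟩
        simp only [Ξ, if_pos h]
        rw [ContinuousLinearMap.norm_smulRight_apply, hv, mul_one, norm_smul, Complex.norm_real,
          norm_norm]
        exact mul_le_mul_of_nonneg_left (hf t) (norm_nonneg _)
      · exact ⟨CR, fun t => by simp only [Ξ, if_neg h]; exact hR t⟩
    obtain ⟨C, hC⟩ := hΞ
    refine ⟨1 * (C * 1), fun t => ?_⟩
    have hC0 : 0 ≤ C := (norm_nonneg _).trans (hC t)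
    refine (ContinuousLinearMap.opNorm_comp_le _ _).trans ?_
    refine mul_le_mul (Submodule.orthogonalProjectionOnto_norm_le _) ?_ (norm_nonneg _) zero_le_one
    refine (ContinuousLinearMap.opNorm_comp_le _ _).trans ?_
    exact mul_le_mul (hC t) (Submodule.norm_subtypeL_le _) (norm_nonneg _) hC0
  · intro t
    symm
    apply he₀
    erw [key n le_rfl t (e.symm 1), he]
    rw [hφ]
    congr 1
    simp only [v, map_smul, smul_eq_mul]
    field_simp

end MdMultiplier

/-! ### Energies and operators on ℓ² -/

/-- The square of the `ℓ²`-norm of a function, as an extended nonnegative number. -/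
noncomputable def energy {X : Type*} (h : X → ℂ) : ENNReal := ∑' p, ‖h p‖ₑ ^ 2

theorem memℓp_two_iff_energy_ne_top {X : Type*} (h : X → ℂ) :
    Memℓp h 2 ↔ energy h ≠ ⊤ := by
  rw [memℓp_gen_iff (by simp)]
  have : energy h = ∑' p, ((‖h p‖₊ ^ 2 : NNReal) : ENNReal) := by
    simp [energy, enorm_eq_nnnorm]
  rw [this, ENNReal.tsum_coe_ne_top_iff_summable, ← NNReal.summable_coe]
  simp

theorem energy_coe_lp {X : Type*} (h : lp (fun _ : X => ℂ) 2) :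
    energy (h : X → ℂ) = ‖h‖ₑ ^ 2 := by
  have h1 := lp.norm_rpow_eq_tsum (p := 2) (by simp) h
  have h2 : ‖h‖ ^ 2 = ∑' i, ‖h i‖ ^ 2 := by simpa using h1
  have hs : Summable fun i => ‖h i‖ ^ 2 := by
    have := (memℓp_gen_iff (p := 2) (by simp)).mp (lp.memℓp h)
    simpa using this
  have h3 : energy (h : X → ℂ) = ∑' i, ENNReal.ofReal (‖h i‖ ^ 2) := by
    simp only [energy]
    congr 1
    funext i
    rw [ENNReal.ofReal_pow (norm_nonneg _), ofReal_norm]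
  rw [h3, ← ENNReal.ofReal_tsum_of_nonneg (fun _ => by positivity) hs, ← h2,
    ENNReal.ofReal_pow (norm_nonneg _), ofReal_norm]

theorem le_sqrt_mul_norm_of_enorm_sq_le {E F : Type*} [NormedAddCommGroup E]
    [NormedAddCommGroup F] {x : E} {y : F} {C : NNReal} (h : ‖y‖ₑ ^ 2 ≤ C * ‖x‖ₑ ^ 2) :
    ‖y‖ ≤ Real.sqrt C * ‖x‖ := by
  have h2 : ‖y‖₊ ^ 2 ≤ C * ‖x‖₊ ^ 2 := by
    simp only [enorm_eq_nnnorm] at h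
    exact_mod_cast h
  have h3 : ‖y‖ ^ 2 ≤ C * ‖x‖ ^ 2 := by exact_mod_cast h2
  apply le_of_sq_le_sq _ (by positivity)
  rw [mul_pow, Real.sq_sqrt C.coe_nonneg]
  exact h3

/-- A linear map on functions that is bounded for the energy acts on `ℓ²`. -/
theorem exists_clm_of_energy_le {X : Type*} (A : (X → ℂ) →ₗ[ℂ] (X → ℂ)) (C : NNReal)
    (hA : ∀ h, energy (A h) ≤ C * energy h) :
    ∃ B : lp (fun _ : X => ℂ) 2 →L[ℂ] lp (fun _ : X => ℂ) 2,
      (∀ h : lp (fun _ : X => ℂ) 2, (B h : X → ℂ) = A h) ∧ ‖B‖ ≤ Real.sqrt C := by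
  have hmem : ∀ h : lp (fun _ : X => ℂ) 2, Memℓp (A h) 2 := by
    intro h
    rw [memℓp_two_iff_energy_ne_top]
    refine ne_top_of_le_ne_top ?_ (hA h)
    exact ENNReal.mul_ne_top ENNReal.coe_ne_top
      ((memℓp_two_iff_energy_ne_top _).mp (lp.memℓp h))
  let B₀ : lp (fun _ : X => ℂ) 2 →ₗ[ℂ] lp (fun _ : X => ℂ) 2 :=
    { toFun := fun h => ⟨A h, hmem h⟩
      map_add' := fun h k => by
        apply Subtype.ext
        exact A.map_add _ _
      map_smul' := fun c h => by
        apply Subtype.ext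
        exact A.map_smul _ _ }
  have hB : ∀ h, ‖B₀ h‖ ≤ Real.sqrt C * ‖h‖ := by
    intro h
    apply le_sqrt_mul_norm_of_enorm_sq_le
    rw [← energy_coe_lp, ← energy_coe_lp]
    exact hA h
  exact ⟨B₀.mkContinuous _ hB, fun h => rfl, B₀.mkContinuous_norm_le (Real.sqrt_nonneg _) hB⟩

/-! ### Letter removal, its resolvent and the conjugated translations -/

namespace FirstLetter

variable {G I : Type*} [Group G] (F : FirstLetter G I) (c : I → I → ℂ) (b : I → I)

/-- The first letter of an element if it is one of the letters with exponent `1`. -/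
def pos (x : G) : Option I :=
  match F.fst x with
  | some (i, true) => some i
  | _ => none

theorem pos_eq_some {x : G} {i : I} : F.pos x = some i ↔ F.fst x = some (i, true) := by
  unfold pos
  split
  · next j h => rw [h]; simp
  · next h =>
    exact ⟨fun h' => by simp at h', fun h' => (h i h').elim⟩

theorem pos_eq_none_of_fst {x : G} {i : I} (h : F.fst x = some (i, false)) : F.pos x = none := by
  unfold pos
  rw [h]

/-- The index reached at level `l` after removing the letter `i`. -/
def levelIndex (b : I → I) (l : ℕ) (i : I) : I := if l = 0 then b i else i

/-- The weighted operator on functions on `G × ℕ × I` that removes a first letter. -/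
def step : (G × ℕ × I → ℂ) →ₗ[ℂ] (G × ℕ × I → ℂ) where
  toFun h p := match p with
    | (_, 0, _) => 0
    | (x, l + 1, q) => (F.pos x).elim 0 fun i => c i q * h ((F.gen i)⁻¹ * x, l, levelIndex b l i)
  map_add' h k := by
    funext ⟨x, l, q⟩
    cases l with
    | zero => simp
    | succ l => cases hx : F.pos x <;> simp [hx, mul_add]
  map_smul' r h := by
    funext ⟨x, l, q⟩
    cases l with
    | zero => simp
    | succ l => cases hx : F.pos x <;> simp [hx, mul_left_comm]

theorem step_zero (h : G × ℕ × I → ℂ) (x : G) (q : I) : F.step c b h (x, 0, q) = 0 := rfl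

theorem step_succ (h : G × ℕ × I → ℂ) (x : G) (l : ℕ) (q : I) :
    F.step c b h (x, l + 1, q) =
      (F.pos x).elim 0 fun i => c i q * h ((F.gen i)⁻¹ * x, l, levelIndex b l i) := rfl

/-- The values of the inverse of `1 - step`, by recursion on the level. -/
def resolventAux (h : G × ℕ × I → ℂ) : ℕ → G → I → ℂ
  | 0, x, q => h (x, 0, q)
  | l + 1, x, q => h (x, l + 1, q) + (F.pos x).elim 0 fun i =>
      c i q * resolventAux h l ((F.gen i)⁻¹ * x) (levelIndex b l i)

/-- The inverse of `1 - step`. -/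
def resolvent : (G × ℕ × I → ℂ) →ₗ[ℂ] (G × ℕ × I → ℂ) where
  toFun h p := F.resolventAux c b h p.2.1 p.1 p.2.2
  map_add' h k := by
    funext ⟨x, l, q⟩
    change F.resolventAux c b (h + k) l x q =
      F.resolventAux c b h l x q + F.resolventAux c b k l x q
    induction l generalizing x q with
    | zero => rfl
    | succ l ih =>
      simp only [resolventAux]
      cases hx : F.pos x with
      | none => simp
      | some i => simp only [Option.elim_some, ih, Pi.add_apply]; ring
  map_smul' r h := by
    funext ⟨x, l, q⟩
    change F.resolventAux c b (r • h) l x q = r * F.resolventAux c b h l x q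
    induction l generalizing x q with
    | zero => rfl
    | succ l ih =>
      simp only [resolventAux]
      cases hx : F.pos x with
      | none => simp
      | some i => simp only [Option.elim_some, ih, Pi.smul_apply, smul_eq_mul]; ring

theorem resolvent_zero (h : G × ℕ × I → ℂ) (x : G) (q : I) :
    F.resolvent c b h (x, 0, q) = h (x, 0, q) := rfl

theorem resolvent_succ (h : G × ℕ × I → ℂ) (x : G) (l : ℕ) (q : I) :
    F.resolvent c b h (x, l + 1, q) = h (x, l + 1, q) + (F.pos x).elim 0 fun i =>
      c i q * F.resolvent c b h ((F.gen i)⁻¹ * x, l, levelIndex b l i) := rfl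

/-- Since `step` lowers the level, the Neumann series is finite at each point; the inverse is exact
on arbitrary functions, with no convergence question. -/
theorem resolvent_sub_step (h : G × ℕ × I → ℂ) :
    F.resolvent c b h - F.step c b (F.resolvent c b h) = h := by
  funext ⟨x, l, q⟩
  cases l with
  | zero => simp [resolvent_zero, step_zero]
  | succ l => simp [resolvent_succ, step_succ]

theorem resolvent_apply_sub_step (h : G × ℕ × I → ℂ) :
    F.resolvent c b (h - F.step c b h) = h := by
  funext ⟨x, l, q⟩
  induction l generalizing x q with
  | zero => simp [resolvent_zero, step_zero]
  | succ l ih =>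
    rw [resolvent_succ]
    cases hx : F.pos x <;> simp [step_succ, hx, ih]

/-- Right translation of functions. -/
def translate (t : G) : (G × ℕ × I → ℂ) →ₗ[ℂ] (G × ℕ × I → ℂ) :=
  LinearMap.funLeft ℂ ℂ fun p => (p.1 * t, p.2)

theorem translate_apply (t : G) (h : G × ℕ × I → ℂ) (x : G) (l : ℕ) (q : I) :
    translate t h (x, l, q) = h (x * t, l, q) := rfl

/-- The regular representation conjugated by `1 - step`. -/
def rep (t : G) : (G × ℕ × I → ℂ) →ₗ[ℂ] (G × ℕ × I → ℂ) :=
  (LinearMap.id - F.step c b) ∘ₗ translate t ∘ₗ F.resolvent c b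

theorem rep_apply (t : G) (h : G × ℕ × I → ℂ) : F.rep c b t h =
    translate t (F.resolvent c b h) - F.step c b (translate t (F.resolvent c b h)) := rfl

theorem resolvent_rep (t : G) (h : G × ℕ × I → ℂ) :
    F.resolvent c b (F.rep c b t h) = translate t (F.resolvent c b h) := by
  rw [rep_apply, resolvent_apply_sub_step]

/-- A geometric series of ratio 1/2 in the sup norm. It makes the functionals f_t uniformly bounded
on ℓ². -/
theorem norm_resolvent_le (hc : ∀ i q, ‖c i q‖ ≤ 1 / 2) (h : G × ℕ × I → ℂ) (M : ℝ)
    (hM : ∀ p, ‖h p‖ ≤ M) (p : G × ℕ × I) : ‖F.resolvent c b h p‖ ≤ 2 * M := by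
  obtain ⟨x, l, q⟩ := p
  have hM0 : 0 ≤ M := (norm_nonneg _).trans (hM (x, l, q))
  induction l generalizing x q with
  | zero => rw [resolvent_zero]; linarith [hM (x, 0, q)]
  | succ l ih =>
    rw [resolvent_succ]
    refine (norm_add_le _ _).trans ?_
    have h1 := hM (x, l + 1, q)
    cases hx : F.pos x with
    | none => simp only [Option.elim_none, norm_zero]; linarith
    | some i =>
      simp only [Option.elim_some, norm_mul]
      have := mul_le_mul (hc i q) (ih ((F.gen i)⁻¹ * x) (levelIndex b l i)) (norm_nonneg _)
        (by norm_num)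
      linarith

end FirstLetter

/-! ### Uniform energy bound for the scaled conjugated translations -/

theorem ENNReal.tsum_le_tsum_of_injOn {α β : Type*} {f : α → ENNReal} {g : β → ENNReal}
    (e : α → β) (s : Set α) (hs : ∀ x ∉ s, f x = 0) (he : Set.InjOn e s)
    (h : ∀ x ∈ s, f x ≤ g (e x)) : ∑' x, f x ≤ ∑' y, g y := by
  have h1 : ∑' x, f x = ∑' x : s, f x := by
    rw [tsum_subtype]
    congr 1
    funext x
    by_cases hx : x ∈ s
    · simp [hx]
    · simp [hx, hs x hx]
  rw [h1]
  calc ∑' x : s, f x ≤ ∑' x : s, g (e x) := ENNReal.tsum_le_tsum fun x => h x x.2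
    _ ≤ ∑' y, g y := ENNReal.tsum_comp_le_tsum_of_injective
      (f := fun x : s => e x) (fun x y hxy => Subtype.ext (he x.2 y.2 hxy)) g

theorem enorm_add_sq_le (u v : ℂ) : ‖u + v‖ₑ ^ 2 ≤ 2 * ‖u‖ₑ ^ 2 + 2 * ‖v‖ₑ ^ 2 := by
  have : ‖u + v‖₊ ^ 2 ≤ 2 * ‖u‖₊ ^ 2 + 2 * ‖v‖₊ ^ 2 := by
    rw [← NNReal.coe_le_coe]
    push_cast
    have := norm_add_le u v
    nlinarith [norm_nonneg (u + v), sq_nonneg (‖u‖ - ‖v‖)]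
  simp only [enorm_eq_nnnorm]
  exact_mod_cast this

theorem enorm_add_sub_sq_le (u v w : ℂ) :
    ‖u + v - w‖ₑ ^ 2 ≤ 3 * ‖u‖ₑ ^ 2 + 3 * ‖v‖ₑ ^ 2 + 3 * ‖w‖ₑ ^ 2 := by
  have : ‖u + v - w‖₊ ^ 2 ≤ 3 * ‖u‖₊ ^ 2 + 3 * ‖v‖₊ ^ 2 + 3 * ‖w‖₊ ^ 2 := by
    rw [← NNReal.coe_le_coe]
    push_cast
    have h1 := norm_sub_le (u + v) w
    have h2 := norm_add_le u v
    have h3 : ‖u + v - w‖ ^ 2 ≤ (‖u‖ + ‖v‖ + ‖w‖) ^ 2 :=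
      pow_le_pow_left₀ (norm_nonneg _) (by linarith) 2
    nlinarith [sq_nonneg (‖u‖ - ‖v‖), sq_nonneg (‖u‖ - ‖w‖), sq_nonneg (‖v‖ - ‖w‖)]
  simp only [enorm_eq_nnnorm]
  exact_mod_cast this

theorem enorm_sq_le_of_norm_le_half {z : ℂ} (hz : ‖z‖ ≤ 1 / 2) : ‖z‖ₑ ^ 2 ≤ 1 / 4 := by
  have h1 : ‖z‖ₑ ^ 2 = ENNReal.ofReal (‖z‖ ^ 2) := by
    rw [ENNReal.ofReal_pow (norm_nonneg _), ofReal_norm]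
  rw [h1, show (1 / 4 : ENNReal) = ENNReal.ofReal (1 / 4) by
    rw [ENNReal.ofReal_div_of_pos (by norm_num)]; simp]
  apply ENNReal.ofReal_le_ofReal
  nlinarith [norm_nonneg z]

namespace FirstLetter

variable {G I : Type*} [Group G] (F : FirstLetter G I) (c : I → I → ℂ) (b : I → I)

/-- The energy of a function on one level. -/
noncomputable def levelEnergy (h : G × ℕ × I → ℂ) (l : ℕ) : ENNReal :=
  ∑' p : G × I, ‖h (p.1, l, p.2)‖ₑ ^ 2

omit [Group G] in
theorem energy_eq_tsum_levelEnergy (h : G × ℕ × I → ℂ) :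
    energy h = ∑' l, levelEnergy h l := by
  simp only [energy, levelEnergy, ENNReal.tsum_prod']
  exact ENNReal.tsum_comm

theorem levelEnergy_translate (t : G) (h : G × ℕ × I → ℂ) (l : ℕ) :
    levelEnergy (translate t h) l = levelEnergy h l := by
  simp only [levelEnergy, translate_apply, ENNReal.tsum_prod']
  exact (Equiv.mulRight t).tsum_eq fun x => ∑' q, ‖h (x, l, q)‖ₑ ^ 2

/-- The pairs `(z, i)` such that `i` is the first letter of `gen i * z`, but no longer after right
multiplication by `t⁻¹`. -/
def path (t : G) : Set (G × I) :=
  {p | F.pos (F.gen p.2 * p.1) = some p.2 ∧ F.pos (F.gen p.2 * p.1 * t⁻¹) ≠ some p.2}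

/-- Multiplying by the inverse generator an element that does not begin with the generator puts the
inverse letter in front. Hence z alone determines i, which makes the reindexings below injective. -/
theorem fst_of_mem_path {t : G} {p : G × I} (hp : p ∈ F.path t) :
    F.fst (p.1 * t⁻¹) = some (p.2, false) := by
  have := F.fst_inv_mul p.2 (F.gen p.2 * p.1 * t⁻¹) (fun h => hp.2 (F.pos_eq_some.mpr h))
  simpa [mul_assoc] using this

theorem path_snd_unique {t : G} {p p' : G × I} (hp : p ∈ F.path t) (hp' : p' ∈ F.path t)
    (h : p.1 = p'.1) : p = p' := by
  have h1 := F.fst_of_mem_path hp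
  rw [h, F.fst_of_mem_path hp'] at h1
  exact Prod.ext h (by simpa using h1.symm)

open Classical in
/-- The energy of the resolvent along the path determined by `t`. -/
noncomputable def pathEnergy (t : G) (h : G × ℕ × I → ℂ) (l : ℕ) : ENNReal :=
  ∑' p : G × I, if p ∈ F.path t then ‖F.resolvent c b h (p.1, l, levelIndex b l p.2)‖ₑ ^ 2 else 0

open Classical in
theorem tsum_path_le_levelEnergy (t : G) (h : G × ℕ × I → ℂ) (l : ℕ) :
    (∑' p : G × I, if p ∈ F.path t then ‖h (p.1, l, levelIndex b l p.2)‖ₑ ^ 2 else 0) ≤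
      levelEnergy h l := by
  refine ENNReal.tsum_le_tsum_of_injOn (fun p => (p.1, levelIndex b l p.2)) (F.path t)
    (fun p hp => if_neg hp) ?_ ?_
  · intro p hp p' hp' h
    exact F.path_snd_unique hp hp' (Prod.ext_iff.mp h).1
  · intro p hp
    rw [if_pos hp]

theorem pathEnergy_zero_le (t : G) (h : G × ℕ × I → ℂ) :
    F.pathEnergy c b t h 0 ≤ levelEnergy h 0 :=
  F.tsum_path_le_levelEnergy b t h 0

theorem pathEnergy_succ_le (hc : ∀ i q, ‖c i q‖ ≤ 1 / 2) (t : G) (h : G × ℕ × I → ℂ) (l : ℕ) :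
    F.pathEnergy c b t h (l + 1) ≤
      2 * levelEnergy h (l + 1) + 2 * (1 / 4 * F.pathEnergy c b t h l) := by
  classical
  let f₁ : G × I → ENNReal := fun p =>
    if p ∈ F.path t then ‖h (p.1, l + 1, levelIndex b (l + 1) p.2)‖ₑ ^ 2 else 0
  let f₂ : G × I → ENNReal := fun p =>
    if p ∈ F.path t then (F.pos p.1).elim 0 fun i =>
      1 / 4 * ‖F.resolvent c b h ((F.gen i)⁻¹ * p.1, l, levelIndex b l i)‖ₑ ^ 2 else 0
  have h1 : F.pathEnergy c b t h (l + 1) ≤ ∑' p, (2 * f₁ p + 2 * f₂ p) := by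
    refine ENNReal.tsum_le_tsum fun p => ?_
    simp only [f₁, f₂]
    split_ifs with hp
    · rw [resolvent_succ]
      refine (enorm_add_sq_le _ _).trans ?_
      gcongr
      cases hx : F.pos p.1 with
      | none => simp
      | some i =>
        simp only [Option.elim_some, enorm_mul, mul_pow]
        gcongr
        exact enorm_sq_le_of_norm_le_half (hc _ _)
    · simp
  have h2 : ∑' p, f₁ p ≤ levelEnergy h (l + 1) := F.tsum_path_le_levelEnergy b t h (l + 1)
  have h3 : ∑' p, f₂ p ≤ 1 / 4 * F.pathEnergy c b t h l := by
    rw [pathEnergy, ← ENNReal.tsum_mul_left]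
    -- Removing the first letter j of z stays on the path: z t⁻¹ begins with a negative letter, so
    -- it cannot begin with j. The map is injective because (g_j⁻¹z, j) gives back z, and z gives
    -- back i.
    refine ENNReal.tsum_le_tsum_of_injOn
      (fun p => (F.pos p.1).elim p fun i => ((F.gen i)⁻¹ * p.1, i))
      {p | p ∈ F.path t ∧ F.pos p.1 ≠ none} ?_ ?_ ?_
    · intro p hp
      simp only [Set.mem_ofPred_eq, not_and_or, not_not] at hp
      simp only [f₂]
      rcases hp with hp | hp
      · rw [if_neg hp]
      · simp [hp]
    · rintro p ⟨hp, hp0⟩ p' ⟨hp', hp0'⟩ hpp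
      obtain ⟨i, hi⟩ := Option.ne_none_iff_exists'.mp hp0
      obtain ⟨i', hi'⟩ := Option.ne_none_iff_exists'.mp hp0'
      simp only [hi, hi', Option.elim_some, Prod.mk.injEq] at hpp
      obtain ⟨h4, rfl⟩ := hpp
      exact F.path_snd_unique hp hp' (mul_left_cancel h4)
    · rintro p ⟨hp, hp0⟩
      obtain ⟨i, hi⟩ := Option.ne_none_iff_exists'.mp hp0
      simp only [f₂, if_pos hp, hi, Option.elim_some]
      rw [if_pos]
      refine ⟨?_, ?_⟩
      · simpa using hi
      · simp only [mul_inv_cancel_left]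
        rw [F.pos_eq_none_of_fst (F.fst_of_mem_path hp)]
        simp
  refine h1.trans ?_
  rw [ENNReal.tsum_add, ENNReal.tsum_mul_left, ENNReal.tsum_mul_left]
  gcongr

theorem tsum_pathEnergy_le (hc : ∀ i q, ‖c i q‖ ≤ 1 / 2) (t : G) (h : G × ℕ × I → ℂ) :
    ∑' l, F.pathEnergy c b t h l ≤ 4 * energy h := by
  -- The recursion says P ≤ 2E + P/2, whence P ≤ 4E; induction on partial sums avoids subtracting
  -- possibly infinite quantities.
  have key : ∀ n, ∑ l ∈ Finset.range n, F.pathEnergy c b t h l ≤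
      4 * ∑ l ∈ Finset.range n, levelEnergy h l := by
    intro n
    induction n with
    | zero => simp
    | succ n ih =>
      have h1 : ∑ l ∈ Finset.range (n + 1), F.pathEnergy c b t h l ≤
          2 * ∑ l ∈ Finset.range (n + 1), levelEnergy h l +
            2 * (1 / 4 * ∑ l ∈ Finset.range n, F.pathEnergy c b t h l) := by
        rw [Finset.sum_range_succ', Finset.sum_range_succ' (fun l => levelEnergy h l)]
        calc _ ≤ ∑ l ∈ Finset.range n, (2 * levelEnergy h (l + 1) +
              2 * (1 / 4 * F.pathEnergy c b t h l)) + 2 * levelEnergy h 0 := by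
              gcongr with l _
              · exact F.pathEnergy_succ_le c b hc t h l
              · refine (F.pathEnergy_zero_le c b t h).trans ?_
                exact le_mul_of_one_le_left zero_le (by norm_num)
          _ = _ := by
              simp only [Finset.sum_add_distrib, Finset.mul_sum, mul_add]
              ring
      refine h1.trans ?_
      calc _ ≤ 2 * ∑ l ∈ Finset.range (n + 1), levelEnergy h l +
            2 * (1 / 4 * (4 * ∑ l ∈ Finset.range (n + 1), levelEnergy h l)) := by
            gcongr
            refine ih.trans ?_
            gcongr
            exact Nat.le_succ n
        _ = _ := by
            rw [← mul_assoc (1 / 4 : ENNReal), ENNReal.div_mul_cancel (by norm_num) (by norm_num)]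
            ring
  refine ENNReal.tsum_le_of_sum_range_le fun n => (key n).trans ?_
  rw [energy_eq_tsum_levelEnergy]
  gcongr
  exact ENNReal.sum_le_tsum _

/-- Multiplication by a function of the last coordinate. -/
def scale (s : I → ℂ) : (G × ℕ × I → ℂ) →ₗ[ℂ] (G × ℕ × I → ℂ) where
  toFun h p := s p.2.2 * h p
  map_add' h k := by funext p; simp [mul_add]
  map_smul' r h := by funext p; simp [mul_left_comm]

omit [Group G] in
theorem scale_apply (s : I → ℂ) (h : G × ℕ × I → ℂ) (p : G × ℕ × I) :
    scale s h p = s p.2.2 * h p := rfl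

-- With z = g_i⁻¹xt, the condition on the first letters of x and xt is membership of (z, i) in the
-- path.
open Classical in
theorem tsum_pos_ne_le_pathEnergy (t : G) (h : G × ℕ × I → ℂ) (l : ℕ) :
    (∑' p : G × I, if F.pos (p.1 * t) = some p.2 ∧ F.pos p.1 ≠ some p.2 then
      ‖F.resolvent c b h ((F.gen p.2)⁻¹ * (p.1 * t), l, levelIndex b l p.2)‖ₑ ^ 2 else 0) ≤
      F.pathEnergy c b t h l := by
  refine ENNReal.tsum_le_tsum_of_injOn (fun p => ((F.gen p.2)⁻¹ * (p.1 * t), p.2))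
    {p | F.pos (p.1 * t) = some p.2 ∧ F.pos p.1 ≠ some p.2} (fun p hp => if_neg hp) ?_ ?_
  · rintro ⟨x, i⟩ _ ⟨x', i'⟩ _ h
    simp only [Prod.mk.injEq] at h
    obtain ⟨h1, rfl⟩ := h
    exact Prod.ext (mul_right_cancel (mul_left_cancel h1)) rfl
  · intro p hp
    rw [if_pos (show _ ∧ _ from hp), if_pos]
    exact ⟨by simpa using hp.1, by simpa [mul_assoc] using hp.2⟩

-- Here z = g_i⁻¹xt begins with the inverse of g_i. So i is determined by z, and there is no
-- positive letter to remove: the resolvent of h at z is just h.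
open Classical in
theorem tsum_pos_ne_le_levelEnergy (t : G) (h : G × ℕ × I → ℂ) (l : ℕ) :
    (∑' p : G × I, if F.pos p.1 = some p.2 ∧ F.pos (p.1 * t) ≠ some p.2 then
      ‖F.resolvent c b h ((F.gen p.2)⁻¹ * (p.1 * t), l, levelIndex b l p.2)‖ₑ ^ 2 else 0) ≤
      levelEnergy h l := by
  have hfst : ∀ p : G × I, F.pos (p.1 * t) ≠ some p.2 →
      F.fst ((F.gen p.2)⁻¹ * (p.1 * t)) = some (p.2, false) := fun p hp =>
    F.fst_inv_mul _ _ fun h => hp (F.pos_eq_some.mpr h)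
  refine ENNReal.tsum_le_tsum_of_injOn
    (fun p => ((F.gen p.2)⁻¹ * (p.1 * t), levelIndex b l p.2))
    {p | F.pos p.1 = some p.2 ∧ F.pos (p.1 * t) ≠ some p.2} (fun p hp => if_neg hp) ?_ ?_
  · rintro ⟨x, i⟩ hp ⟨x', i'⟩ hp' h
    simp only [Prod.mk.injEq] at h
    have h1 := hfst _ hp.2
    have h2 := hfst _ hp'.2
    simp only at h1 h2
    rw [h.1, h2] at h1
    simp only [Option.some.injEq, Prod.mk.injEq, and_true] at h1
    subst h1
    exact Prod.ext (mul_right_cancel (mul_left_cancel h.1)) rfl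
  · intro p hp
    rw [if_pos (show _ ∧ _ from hp)]
    have h0 := F.pos_eq_none_of_fst (hfst p hp.2)
    cases l with
    | zero => rw [resolvent_zero]
    | succ l => rw [resolvent_succ, h0]; simp

/-- Apart from the translate of h, two terms remain, one from the letter of xt and one from that of
x. They evaluate the resolvent at points of the same form and cancel when the letters agree. Writing
the rest as sums over i allows summation over q first, later on. -/
theorem enorm_sq_scale_rep_le (s : I → ℂ) (hs : ∀ q, ‖s q‖ ≤ 1) (t : G) (h : G × ℕ × I → ℂ)
    (x : G) (l : ℕ) (q : I) (QA QB : I → ENNReal)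
    (hA : ∀ i, F.pos (x * t) = some i → F.pos x ≠ some i →
      ‖F.resolvent c b h ((F.gen i)⁻¹ * (x * t), l, levelIndex b l i)‖ₑ ^ 2 ≤ QA i)
    (hB : ∀ i, F.pos x = some i → F.pos (x * t) ≠ some i →
      ‖F.resolvent c b h ((F.gen i)⁻¹ * (x * t), l, levelIndex b l i)‖ₑ ^ 2 ≤ QB i) :
    ‖scale s (F.rep c b t h) (x, l + 1, q)‖ₑ ^ 2 ≤ 3 * ‖translate t h (x, l + 1, q)‖ₑ ^ 2 +
      3 * ∑' i, ‖s q * c i q‖ₑ ^ 2 * QA i + 3 * ∑' i, ‖s q * c i q‖ₑ ^ 2 * QB i := by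
  have hs' : ‖s q‖ₑ ≤ 1 := by
    rw [← ofReal_norm]
    exact ENNReal.ofReal_le_one.mpr (hs q)
  have hsh : ‖s q * h (x * t, l + 1, q)‖ₑ ^ 2 ≤ ‖translate t h (x, l + 1, q)‖ₑ ^ 2 := by
    rw [translate_apply, enorm_mul]
    gcongr
    exact mul_le_of_le_one_left (zero_le) hs'
  have hform : scale s (F.rep c b t h) (x, l + 1, q) = s q * h (x * t, l + 1, q) +
      (F.pos (x * t)).elim 0 (fun i => s q * c i q *
        F.resolvent c b h ((F.gen i)⁻¹ * (x * t), l, levelIndex b l i)) -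
      (F.pos x).elim 0 (fun i => s q * c i q *
        F.resolvent c b h ((F.gen i)⁻¹ * (x * t), l, levelIndex b l i)) := by
    rw [scale_apply, rep_apply, Pi.sub_apply, step_succ, translate_apply, resolvent_succ]
    cases hx : F.pos x <;> cases hxt : F.pos (x * t) <;>
      simp only [Option.elim_none, Option.elim_some, translate_apply, mul_assoc] <;> ring
  rw [hform]
  by_cases heq : F.pos (x * t) = F.pos x
  · rw [heq, add_sub_cancel_right]
    refine hsh.trans ?_
    rw [add_assoc]
    refine le_trans ?_ le_self_add
    exact le_mul_of_one_le_left (zero_le) (by norm_num)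
  · refine (enorm_add_sub_sq_le _ _ _).trans ?_
    gcongr
    · cases hxt : F.pos (x * t) with
      | none => simp
      | some i =>
        refine le_trans ?_ (ENNReal.le_tsum i)
        rw [Option.elim_some, enorm_mul, mul_pow]
        gcongr
        exact hA i hxt (fun h => heq (hxt.trans h.symm))
    · cases hx : F.pos x with
      | none => simp
      | some i =>
        refine le_trans ?_ (ENNReal.le_tsum i)
        rw [Option.elim_some, enorm_mul, mul_pow]
        gcongr
        exact hB i hx (fun h => heq (h.trans hx.symm))

theorem levelEnergy_scale_rep_succ_le (s : I → ℂ) (hs : ∀ q, ‖s q‖ ≤ 1)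
    (hsc : ∀ i, ∑' q, ‖s q * c i q‖ₑ ^ 2 ≤ 1) (t : G) (h : G × ℕ × I → ℂ) (l : ℕ) :
    levelEnergy (scale s (F.rep c b t h)) (l + 1) ≤
      3 * levelEnergy h (l + 1) + 3 * F.pathEnergy c b t h l + 3 * levelEnergy h l := by
  classical
  let QA : G → I → ENNReal := fun x i =>
    if F.pos (x * t) = some i ∧ F.pos x ≠ some i then
      ‖F.resolvent c b h ((F.gen i)⁻¹ * (x * t), l, levelIndex b l i)‖ₑ ^ 2 else 0
  let QB : G → I → ENNReal := fun x i =>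
    if F.pos x = some i ∧ F.pos (x * t) ≠ some i then
      ‖F.resolvent c b h ((F.gen i)⁻¹ * (x * t), l, levelIndex b l i)‖ₑ ^ 2 else 0
  -- `Q` does not depend on q, so summing over q first leaves only the column sums in `hsc`. This is
  -- where the scaling is indispensable: the unscaled Fourier columns have square sum N/4.
  have hQ : ∀ Q : G → I → ENNReal,
      ∑' p : G × I, ∑' i, ‖s p.2 * c i p.2‖ₑ ^ 2 * Q p.1 i ≤ ∑' p : G × I, Q p.1 p.2 := by
    intro Q
    rw [ENNReal.tsum_prod', ENNReal.tsum_prod']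
    refine ENNReal.tsum_le_tsum fun x => ?_
    rw [ENNReal.tsum_comm]
    refine ENNReal.tsum_le_tsum fun i => ?_
    change ∑' a, ‖s a * c i a‖ₑ ^ 2 * Q x i ≤ Q x i
    rw [ENNReal.tsum_mul_right]
    exact mul_le_of_le_one_left (zero_le) (hsc i)
  calc levelEnergy (scale s (F.rep c b t h)) (l + 1)
      ≤ ∑' p : G × I, (3 * ‖translate t h (p.1, l + 1, p.2)‖ₑ ^ 2 +
          3 * ∑' i, ‖s p.2 * c i p.2‖ₑ ^ 2 * QA p.1 i +
          3 * ∑' i, ‖s p.2 * c i p.2‖ₑ ^ 2 * QB p.1 i) := by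
        refine ENNReal.tsum_le_tsum fun p => ?_
        refine F.enorm_sq_scale_rep_le c b s hs t h p.1 l p.2 _ _ ?_ ?_
        · intro i h1 h2
          simp only [QA]
          rw [if_pos ⟨h1, h2⟩]
        · intro i h1 h2
          simp only [QB]
          rw [if_pos ⟨h1, h2⟩]
    _ = 3 * levelEnergy (translate t h) (l + 1) +
          3 * ∑' p : G × I, ∑' i, ‖s p.2 * c i p.2‖ₑ ^ 2 * QA p.1 i +
          3 * ∑' p : G × I, ∑' i, ‖s p.2 * c i p.2‖ₑ ^ 2 * QB p.1 i := by
        rw [ENNReal.tsum_add, ENNReal.tsum_add, ENNReal.tsum_mul_left, ENNReal.tsum_mul_left,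
          ENNReal.tsum_mul_left]
        rfl
    _ ≤ _ := by
        rw [levelEnergy_translate]
        gcongr
        · exact (hQ QA).trans (F.tsum_pos_ne_le_pathEnergy c b t h l)
        · exact (hQ QB).trans (F.tsum_pos_ne_le_levelEnergy c b t h l)

theorem energy_scale_rep_le (hc : ∀ i q, ‖c i q‖ ≤ 1 / 2) (s : I → ℂ) (hs : ∀ q, ‖s q‖ ≤ 1)
    (hsc : ∀ i, ∑' q, ‖s q * c i q‖ₑ ^ 2 ≤ 1) (t : G) (h : G × ℕ × I → ℂ) :
    energy (scale s (F.rep c b t h)) ≤ 18 * energy h := by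
  have h0 : levelEnergy (scale s (F.rep c b t h)) 0 ≤ 3 * levelEnergy h 0 := by
    rw [← levelEnergy_translate t h, levelEnergy, levelEnergy, ← ENNReal.tsum_mul_left]
    refine ENNReal.tsum_le_tsum fun p => ?_
    have : scale s (F.rep c b t h) (p.1, 0, p.2) = s p.2 * translate t h (p.1, 0, p.2) := by
      rw [scale_apply, rep_apply, Pi.sub_apply, step_zero, sub_zero]
      rfl
    rw [this, enorm_mul]
    have hs' : ‖s p.2‖ₑ ≤ 1 := by
      rw [← ofReal_norm]
      exact ENNReal.ofReal_le_one.mpr (hs p.2)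
    calc _ ≤ ‖translate t h (p.1, 0, p.2)‖ₑ ^ 2 := by
          gcongr
          exact mul_le_of_le_one_left (zero_le) hs'
      _ ≤ _ := le_mul_of_one_le_left (zero_le) (by norm_num)
  have hE : energy h = levelEnergy h 0 + ∑' l, levelEnergy h (l + 1) := by
    rw [energy_eq_tsum_levelEnergy, tsum_eq_zero_add' ENNReal.summable]
  rw [energy_eq_tsum_levelEnergy, tsum_eq_zero_add' ENNReal.summable]
  calc _ ≤ 3 * levelEnergy h 0 + ∑' l, (3 * levelEnergy h (l + 1) +
        3 * F.pathEnergy c b t h l + 3 * levelEnergy h l) := by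
        gcongr with l
        exact F.levelEnergy_scale_rep_succ_le c b s hs hsc t h l
    _ = 3 * energy h + 3 * ∑' l, F.pathEnergy c b t h l + 3 * energy h := by
        rw [ENNReal.tsum_add, ENNReal.tsum_add, ENNReal.tsum_mul_left, ENNReal.tsum_mul_left,
          ENNReal.tsum_mul_left, ← energy_eq_tsum_levelEnergy, hE]
        ring
    -- The constant 18 is 3 + 12 + 3: translate, path term, and the term where the resolvent is
    -- trivial.
    _ ≤ 3 * energy h + 3 * (4 * energy h) + 3 * energy h := by
        gcongr
        exact F.tsum_pathEnergy_le c b hc t h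
    _ = _ := by ring

end FirstLetter

/-! ### Word weights and the Fourier upper bound -/

/-- The product of the transition weights along a word, starting from a given letter. -/
def wordWeight {J : Type*} (V : J → J → ℂ) : List J → J → ℂ
  | [], _ => 1
  | i :: L, q => V i q * wordWeight V L i

theorem wordWeight_append_singleton {J : Type*} (V : J → J → ℂ) (L : List J) (i q : J) :
    wordWeight V (L ++ [i]) q = wordWeight V L q * V i (L.getLastD q) := by
  induction L generalizing q with
  | nil => simp [wordWeight]
  | cons j L ih =>
    rw [List.cons_append, wordWeight, ih, wordWeight, mul_assoc]
    simp only [List.getLastD_cons]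

theorem wordWeight_mul {J : Type*} (V V' : J → J → ℂ) (L : List J) (q : J) :
    wordWeight (fun i j => V i j * V' i j) L q = wordWeight V L q * wordWeight V' L q := by
  induction L generalizing q with
  | nil => simp [wordWeight]
  | cons j L ih => simp only [wordWeight, ih]; ring

theorem wordWeight_const {J : Type*} (r : ℂ) (L : List J) (q : J) :
    wordWeight (fun _ _ => r) L q = r ^ L.length := by
  induction L generalizing q with
  | nil => simp [wordWeight]
  | cons j L ih => simp only [wordWeight, ih, List.length_cons, pow_succ']

namespace MdMultiplier

/-- Parseval's identity for the discrete Fourier transform of vectors. -/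
theorem sum_norm_sq_fourier {E : Type*} [NormedAddCommGroup E] [InnerProductSpace ℂ E] (N : ℕ)
    [NeZero N] (u : ZMod N → E) :
    ∑ j, ‖∑ i, (starRingEnd ℂ) (ZMod.stdAddChar (i * j)) • u i‖ ^ 2 = N * ∑ i, ‖u i‖ ^ 2 := by
  have horth : ∀ i i' : ZMod N,
      ∑ j, (ZMod.stdAddChar (i * j) : ℂ) * (starRingEnd ℂ) (ZMod.stdAddChar (i' * j)) =
        if i = i' then (N : ℂ) else 0 := by
    intro i i'
    have h := AddChar.sum_mulShift (i - i') (ZMod.isPrimitive_stdAddChar N)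
    rw [ZMod.card] at h
    simp only [sub_eq_zero] at h
    push_cast at h
    rw [← h]
    refine Finset.sum_congr rfl fun j _ => ?_
    rw [← AddChar.map_neg_eq_conj, ← AddChar.map_add_eq_mul]
    congr 1
    ring
  have hC : ((∑ j, ‖∑ i, (starRingEnd ℂ) (ZMod.stdAddChar (i * j)) • u i‖ ^ 2 : ℝ) : ℂ) =
      ((N * ∑ i, ‖u i‖ ^ 2 : ℝ) : ℂ) := by
    push_cast
    calc ∑ j, ((‖∑ i, (starRingEnd ℂ) (ZMod.stdAddChar (i * j)) • u i‖ : ℝ) : ℂ) ^ 2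
        = ∑ j, ∑ i, ∑ i', ((ZMod.stdAddChar (i * j) : ℂ) *
            (starRingEnd ℂ) (ZMod.stdAddChar (i' * j))) * inner ℂ (u i) (u i') := by
          refine Finset.sum_congr rfl fun j _ => ?_
          rw [← RCLike.ofReal_eq_complex_ofReal, ← inner_self_eq_norm_sq_to_K, sum_inner]
          refine Finset.sum_congr rfl fun i _ => ?_
          rw [inner_sum]
          refine Finset.sum_congr rfl fun i' _ => ?_
          rw [inner_smul_left, inner_smul_right, Complex.conj_conj, mul_assoc]
      _ = ∑ i, ∑ i', (∑ j, (ZMod.stdAddChar (i * j) : ℂ) *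
            (starRingEnd ℂ) (ZMod.stdAddChar (i' * j))) * inner ℂ (u i) (u i') := by
          rw [Finset.sum_comm]
          refine Finset.sum_congr rfl fun i _ => ?_
          rw [Finset.sum_comm]
          refine Finset.sum_congr rfl fun i' _ => ?_
          rw [Finset.sum_mul]
      _ = ∑ i, (N : ℂ) * inner ℂ (u i) (u i) := by
          refine Finset.sum_congr rfl fun i _ => ?_
          simp [horth]
      _ = _ := by
          rw [Finset.mul_sum]
          refine Finset.sum_congr rfl fun i _ => ?_
          rw [inner_self_eq_norm_sq_to_K]
          rfl
  exact_mod_cast hC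

section

variable {G : Type u} (H : ℕ → Type u) [∀ i, NormedAddCommGroup (H i)]
  [∀ i, InnerProductSpace ℂ (H i)] (ξ : ∀ i : ℕ, G → (H (i + 1) →L[ℂ] H i))

/-- Weighted sums of the products `chainProd`, by recursion on the length. -/
noncomputable def chainSum {J : Type} [Fintype J] (V : J → J → ℂ) (g : J → G) :
    (d : ℕ) → (J → H d) → (J → H 0)
  | 0, v => v
  | d + 1, v => chainSum V g d fun j => ∑ i, V i j • ξ d (g i) (v i)

/-- The last letter acts first, so it selects the component of v; the default j matters only for the
empty word. -/
theorem chainSum_eq {J : Type} [Fintype J] (V : J → J → ℂ) (g : J → G) (d : ℕ) (v : J → H d)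
    (j : J) : chainSum H ξ V g d v j = ∑ t : Fin d → J, wordWeight V (List.ofFn t) j •
      chainProd H ξ d (fun i => g (t i)) (v ((List.ofFn t).getLastD j)) := by
  induction d with
  | zero => simp [chainSum, wordWeight, chainProd]
  | succ d ih =>
    rw [chainSum, ih, ← (Fin.snocEquiv fun _ => J).sum_comp, Fintype.sum_prod_type,
      Finset.sum_comm]
    refine Finset.sum_congr rfl fun t _ => ?_
    rw [map_sum, Finset.smul_sum]
    refine Finset.sum_congr rfl fun i _ => ?_
    have h1 : List.ofFn (Fin.snocEquiv (fun _ => J) (i, t)) = List.ofFn t ++ [i] := by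
      rw [List.ofFn_succ', List.concat_eq_append]
      simp [Fin.snocEquiv]
    have h2 : (chainProd H ξ (d + 1) fun k => g (Fin.snocEquiv (fun _ => J) (i, t) k)) =
        (chainProd H ξ d fun k => g (t k)).comp (ξ d (g i)) := by
      rw [chainProd]
      simp [Fin.snocEquiv]
    rw [h1, h2, wordWeight_append_singleton, map_smul, smul_smul]
    simp

/-- Each stage applies operators of norm at most C componentwise, then a Fourier transform, which by
Parseval multiplies the square sum by N. -/
theorem sum_norm_sq_chainSum_le (N : ℕ) [NeZero N] (g : ZMod N → G) (C : ℝ) (d : ℕ)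
    (hC : ∀ i < d, ∀ t, ‖ξ i t‖ ≤ C) (v : ZMod N → H d) :
    ∑ j, ‖chainSum H ξ (fun i j => (starRingEnd ℂ) (ZMod.stdAddChar (i * j))) g d v j‖ ^ 2 ≤
      (N * C ^ 2) ^ d * ∑ j, ‖v j‖ ^ 2 := by
  induction d with
  | zero => simp [chainSum]
  | succ d ih =>
    rw [chainSum]
    refine (ih (fun i hi => hC i (by omega)) _).trans ?_
    rw [sum_norm_sq_fourier, pow_succ (N * C ^ 2 : ℝ), mul_assoc ((N * C ^ 2 : ℝ) ^ d)]
    have h : ∑ i, ‖ξ d (g i) (v i)‖ ^ 2 ≤ C ^ 2 * ∑ j, ‖v j‖ ^ 2 := by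
      rw [Finset.mul_sum]
      refine Finset.sum_le_sum fun i _ => ?_
      rw [← mul_pow]
      gcongr
      exact (ContinuousLinearMap.le_opNorm _ _).trans
        (mul_le_mul_of_nonneg_right (hC d (by omega) _) (norm_nonneg _))
    refine mul_le_mul_of_nonneg_left ?_ (by positivity)
    rw [mul_assoc]
    gcongr

end

/-- A function with a decomposition of length `m` cannot be too large on the words of length `m`
on which its phases are prescribed by a Fourier matrix. -/
theorem Decomposition.exists_bound {G : Type u} [Group G] {m : ℕ} {φ : G → ℂ}
    (D : Decomposition m φ) : ∃ C : ℝ, ∀ (N : ℕ) [NeZero N] (g : ZMod N → G) (r : ℝ),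
      (∀ t : Fin m → ZMod N, φ (List.ofFn fun i => g (t i)).prod =
        r * wordWeight (fun i j => ZMod.stdAddChar (i * j)) (List.ofFn t) 0) →
      r ^ 2 * N ^ m ≤ C * N := by
  obtain ⟨H, e₀, e, ξ, hb, hξ⟩ := D
  obtain ⟨C, hC⟩ : ∃ C : ℝ, ∀ i < m, ∀ t, ‖ξ i t‖ ≤ C := by
    choose! B hB using hb
    refine ⟨∑ i ∈ Finset.range m, |B i|, fun i hi t => (hB i hi t).trans ?_⟩
    exact (le_abs_self _).trans (Finset.single_le_sum (f := fun i => |B i|)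
      (fun _ _ => abs_nonneg _) (Finset.mem_range.mpr hi))
  refine ⟨(C ^ 2) ^ m, fun N _ g r hr => ?_⟩
  have h1 := sum_norm_sq_chainSum_le H ξ N g C m hC (fun _ => e.symm 1)
  have h2 := Finset.single_le_sum (f := fun j => ‖chainSum H ξ
    (fun i j => (starRingEnd ℂ) (ZMod.stdAddChar (i * j))) g m (fun _ => e.symm 1) j‖ ^ 2)
    (fun _ _ => by positivity) (Finset.mem_univ (0 : ZMod N))
  have h3 := h2.trans h1
  rw [← e₀.norm_map, chainSum_eq, map_sum] at h3
  -- The conjugate phases cancel those of φ, so all N^m words contribute the same r.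
  have h4 : ∀ t : Fin m → ZMod N, e₀ (wordWeight
      (fun i j => (starRingEnd ℂ) (ZMod.stdAddChar (i * j))) (List.ofFn t) 0 •
        chainProd H ξ m (fun i => g (t i)) (e.symm 1)) = r := by
    intro t
    rw [map_smul, ← hξ, hr, smul_eq_mul, mul_left_comm, ← wordWeight_mul]
    have : ∀ i j : ZMod N, (starRingEnd ℂ) (ZMod.stdAddChar (i * j) : ℂ) *
        ZMod.stdAddChar (i * j) = 1 := by
      intro i j
      rw [mul_comm, Complex.mul_conj, Complex.normSq_eq_norm_sq, AddChar.norm_apply]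
      simp
    simp only [this, wordWeight_const]
    simp
  rw [Finset.sum_congr rfl fun t _ => h4 t] at h3
  simp only [Finset.sum_const, Finset.card_univ, Fintype.card_pi, ZMod.card, Finset.prod_const,
    Fintype.card_fin, nsmul_eq_mul, LinearIsometryEquiv.norm_map, norm_mul, Complex.norm_natCast,
    Complex.norm_real, norm_one, one_pow, mul_one, Real.norm_eq_abs, Nat.cast_pow,
    norm_pow, mul_pow, sq_abs] at h3
  have hN : (0 : ℝ) < (N : ℝ) ^ m := by
    have := NeZero.pos N
    positivity
  have h5 : (N : ℝ) ^ m * (r ^ 2 * N ^ m) ≤ N ^ m * ((C ^ 2) ^ m * N) := by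
    calc _ = ((N : ℝ) ^ m) ^ 2 * r ^ 2 := by ring
      _ ≤ _ := h3
      _ = _ := by ring
  exact le_of_mul_le_mul_left h5 hN

end MdMultiplier

/-! ### Values on positive words, and commutation with the scaling -/

namespace FirstLetter

variable {G I : Type*} [Group G] (F : FirstLetter G I) (c : I → I → ℂ) (b : I → I)

theorem fst_list_prod (L : List I) (i : I) : F.fst (L.map F.gen).prod ≠ some (i, false) := by
  induction L generalizing i with
  | nil => simp [F.fst_one]
  | cons j L ih =>
    rw [List.map_cons, List.prod_cons, F.fst_gen_mul j _ (ih j)]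
    simp

theorem pos_list_prod_cons (L : List I) (i : I) :
    F.pos ((i :: L).map F.gen).prod = some i := by
  rw [F.pos_eq_some, List.map_cons, List.prod_cons]
  exact F.fst_gen_mul i _ (F.fst_list_prod L i)

theorem resolvent_list_prod_cons (w : G × ℕ × I → ℂ) (hw : ∀ x l q, w (x, l + 1, q) = 0)
    (L : List I) (i q : I) :
    F.resolvent c b w (((i :: L).map F.gen).prod, L.length + 1, q) =
      c i q * F.resolvent c b w ((L.map F.gen).prod, L.length, levelIndex b L.length i) := by
  rw [resolvent_succ, hw, zero_add, F.pos_list_prod_cons, Option.elim_some, List.map_cons,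
    List.prod_cons, inv_mul_cancel_left]

/-- Level and length agree, so level 0 is reached exactly at the identity. The last letter is sent
to the common base index, so one value of w serves the whole block; for the empty word the index
would still be q. -/
theorem resolvent_list_prod (w : G × ℕ × I → ℂ) (hw : ∀ x l q, w (x, l + 1, q) = 0) (q₀ : I)
    (L : List I) (hL : L ≠ []) (hb : ∀ i ∈ L, b i = q₀) (q : I) :
    F.resolvent c b w ((L.map F.gen).prod, L.length, q) = wordWeight c L q * w (1, 0, q₀) := by
  induction L generalizing q with
  | nil => exact absurd rfl hL
  | cons i L ih =>
    rw [List.length_cons, F.resolvent_list_prod_cons c b w hw, wordWeight, mul_assoc]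
    congr 1
    cases L with
    | nil => simp [resolvent_zero, levelIndex, hb i (by simp), wordWeight]
    | cons j L =>
      rw [ih (by simp) fun k hk => hb k (List.mem_cons_of_mem _ hk)]
      simp [levelIndex]

section

variable {c b} {s : I → ℂ} (hs : ∀ i q l, c i q ≠ 0 → s (levelIndex b l i) = s q)
include hs

/-- By `hs` the scaling is constant along every transition of nonzero weight. -/
theorem step_scale (h : G × ℕ × I → ℂ) :
    F.step c b (scale s h) = scale s (F.step c b h) := by
  funext ⟨x, l, q⟩
  cases l with
  | zero => simp [step_zero, scale_apply]
  | succ l =>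
    rw [scale_apply, step_succ, step_succ]
    cases hx : F.pos x with
    | none => simp
    | some i =>
      simp only [Option.elim_some, scale_apply]
      by_cases hc : c i q = 0
      · simp [hc]
      · rw [hs i q l hc]; ring

theorem resolvent_scale (h : G × ℕ × I → ℂ) :
    F.resolvent c b (scale s h) = scale s (F.resolvent c b h) := by
  conv_lhs => rw [← F.resolvent_sub_step c b h]
  rw [map_sub, ← F.step_scale hs, F.resolvent_apply_sub_step]

theorem rep_scale (t : G) (h : G × ℕ × I → ℂ) :
    F.rep c b t (scale s h) = scale s (F.rep c b t h) := by
  have htr : ∀ k : G × ℕ × I → ℂ, translate t (scale s k) = scale s (translate t k) :=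
    fun _ => rfl
  rw [rep_apply, rep_apply, F.resolvent_scale hs, htr, F.step_scale hs, map_sub]

end

end FirstLetter

namespace FirstLetter

variable {G I : Type*} [Group G] (F : FirstLetter G I) (c : I → I → ℂ) (b : I → I)

omit [Group G] in
theorem energy_scale_le (s : I → ℂ) (hs : ∀ q, ‖s q‖ ≤ 1) (h : G × ℕ × I → ℂ) :
    energy (scale s h) ≤ energy h := by
  refine ENNReal.tsum_le_tsum fun p => ?_
  have hs' : ‖s p.2.2‖ₑ ≤ 1 := by
    rw [← ofReal_norm]
    exact ENNReal.ofReal_le_one.mpr (hs p.2.2)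
  rw [scale_apply, enorm_mul]
  gcongr
  exact mul_le_of_le_one_left zero_le hs'

/-- Evaluation of the resolvent at a point, as a functional on `ℓ²`. -/
theorem exists_evalResolvent (hc : ∀ i q, ‖c i q‖ ≤ 1 / 2) (p : G × ℕ × I) :
    ∃ e : lp (fun _ : G × ℕ × I => ℂ) 2 →L[ℂ] ℂ,
      (∀ h, e h = F.resolvent c b (h : G × ℕ × I → ℂ) p) ∧ ‖e‖ ≤ 2 := by
  let e₀ : lp (fun _ : G × ℕ × I => ℂ) 2 →ₗ[ℂ] ℂ :=
    { toFun := fun h => F.resolvent c b (h : G × ℕ × I → ℂ) p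
      map_add' := fun h k => by rw [lp.coeFn_add, map_add]; rfl
      map_smul' := fun r h => by rw [lp.coeFn_smul, map_smul]; rfl }
  have he : ∀ h, ‖e₀ h‖ ≤ 2 * ‖h‖ := fun h =>
    F.norm_resolvent_le c b hc h ‖h‖ (fun p => lp.norm_apply_le_norm (by simp) h p) p
  exact ⟨e₀.mkContinuous 2 he, fun h => rfl, e₀.mkContinuous_norm_le (by norm_num) he⟩

end FirstLetter

/-! ### Fourier blocks and the separating multiplier -/

namespace MdMultiplier

/-- The letters, grouped into blocks of size `64 ^ k`. -/
abbrev Letter : Type := Σ k : ℕ, ZMod (64 ^ k)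

/-- The transition weights: half a Fourier matrix on each block. -/
noncomputable def fourierWeight (i q : Letter) : ℂ :=
  if h : i.1 = q.1 then ZMod.stdAddChar ((h ▸ i.2 : ZMod (64 ^ q.1)) * q.2) / 2 else 0

/-- The first letter of the block of a letter. -/
def blockBase (i : Letter) : Letter := ⟨i.1, 0⟩

/-- The inverse square root of the block size. -/
noncomputable def blockScale (q : Letter) : ℂ := ((8 : ℂ) ^ q.1)⁻¹

theorem fourierWeight_block (k : ℕ) (i j : ZMod (64 ^ k)) :
    fourierWeight ⟨k, i⟩ ⟨k, j⟩ = ZMod.stdAddChar (i * j) / 2 := by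
  simp [fourierWeight]

theorem fourierWeight_of_ne {i q : Letter} (h : i.1 ≠ q.1) : fourierWeight i q = 0 := by
  simp [fourierWeight, h]

theorem norm_fourierWeight_le (i q : Letter) : ‖fourierWeight i q‖ ≤ 1 / 2 := by
  obtain ⟨k, i⟩ := i
  obtain ⟨k', q⟩ := q
  by_cases h : k = k'
  · subst h
    rw [fourierWeight_block, norm_div, AddChar.norm_apply]
    simp
  · rw [fourierWeight_of_ne (by exact h)]
    simp

theorem norm_blockScale (q : Letter) : ‖blockScale q‖ = ((8 : ℝ) ^ q.1)⁻¹ := by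
  simp [blockScale]

theorem norm_blockScale_le (q : Letter) : ‖blockScale q‖ ≤ 1 := by
  rw [norm_blockScale]
  exact inv_le_one_of_one_le₀ (one_le_pow₀ (by norm_num))

theorem blockScale_levelIndex (i q : Letter) (l : ℕ) (h : fourierWeight i q ≠ 0) :
    blockScale (FirstLetter.levelIndex blockBase l i) = blockScale q := by
  have h1 : i.1 = q.1 := by
    by_contra hne
    exact h (fourierWeight_of_ne hne)
  have h2 : (FirstLetter.levelIndex blockBase l i).1 = i.1 := by
    unfold FirstLetter.levelIndex
    split_ifs <;> rfl
  rw [blockScale, blockScale, h2, h1]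

/-- Only the block of i contributes: N = 64^k terms, each at most N⁻¹ because the scale is 8^(-k) =
N^(-1/2). -/
theorem tsum_blockScale_mul_fourierWeight_le (i : Letter) :
    ∑' q, ‖blockScale q * fourierWeight i q‖ₑ ^ 2 ≤ 1 := by
  obtain ⟨k, i⟩ := i
  rw [ENNReal.tsum_sigma', tsum_eq_single k, tsum_fintype]
  · have : ∀ j : ZMod (64 ^ k), ‖blockScale ⟨k, j⟩ * fourierWeight ⟨k, i⟩ ⟨k, j⟩‖ₑ ^ 2 ≤
        ((64 ^ k : ℕ) : ENNReal)⁻¹ := by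
      intro j
      rw [← ofReal_norm, ← ENNReal.ofReal_pow (norm_nonneg _), ← ENNReal.ofReal_natCast,
        ← ENNReal.ofReal_inv_of_pos (by positivity)]
      apply ENNReal.ofReal_le_ofReal
      rw [norm_mul, mul_pow, norm_blockScale]
      have h1 : (((8 : ℝ) ^ k)⁻¹) ^ 2 = (((64 ^ k : ℕ) : ℝ))⁻¹ := by
        rw [inv_pow, ← pow_mul, mul_comm k 2, pow_mul]
        norm_num
      rw [h1]
      have h2 := norm_fourierWeight_le ⟨k, i⟩ ⟨k, j⟩
      have h3 : ‖fourierWeight ⟨k, i⟩ ⟨k, j⟩‖ ^ 2 ≤ 1 :=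
        pow_le_one₀ (norm_nonneg _) (h2.trans (by norm_num))
      exact mul_le_of_le_one_right (by positivity) h3
    refine (Finset.sum_le_sum fun j _ => this j).trans ?_
    rw [Finset.sum_const, Finset.card_univ, ZMod.card, nsmul_eq_mul, ENNReal.mul_inv_cancel]
    · simp
    · exact ENNReal.natCast_ne_top _
  · intro k' hk'
    simp [fourierWeight_of_ne (i := ⟨k, i⟩) (q := ⟨k', _⟩) (Ne.symm hk')]

/-- The vector at the base point of the group, with a geometric sequence of coefficients on the
blocks. -/
noncomputable def baseFun (G : Type u) [Group G] : G × ℕ × Letter → ℂ := by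
  classical
  -- One point per block keeps the ℓ² norm finite independently of the block sizes.
  exact fun p => if p.1 = 1 ∧ p.2.1 = 0 ∧ p.2.2.2 = 0 then (1 / 2) ^ p.2.2.1 else 0

theorem baseFun_succ {G : Type u} [Group G] (x : G) (l : ℕ) (q : Letter) :
    baseFun G (x, l + 1, q) = 0 := by
  simp [baseFun]

theorem baseFun_base {G : Type u} [Group G] (k : ℕ) :
    baseFun G (1, 0, ⟨k, 0⟩) = (1 / 2) ^ k := by
  simp [baseFun]

theorem memℓp_baseFun (G : Type u) [Group G] : Memℓp (baseFun G) 2 := by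
  rw [memℓp_two_iff_energy_ne_top]
  have h : energy (baseFun G) ≤ ∑' k : ℕ, (2⁻¹ : ENNReal) ^ k := by
    refine ENNReal.tsum_le_tsum_of_injOn (fun p => p.2.2.1)
      {p | p.1 = 1 ∧ p.2.1 = 0 ∧ p.2.2.2 = 0} ?_ ?_ ?_
    · intro p hp
      rw [baseFun, if_neg (by exact hp)]
      simp
    · rintro ⟨x, l, k, j⟩ ⟨h1, h2, h3⟩ ⟨x', l', k', j'⟩ ⟨h1', h2', h3'⟩ h
      simp only at h h1 h2 h3 h1' h2' h3'
      subst h h1 h2 h1' h2'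
      rw [h3, h3']
    · intro p hp
      rw [baseFun, if_pos (by exact hp), enorm_pow, ← ofReal_norm]
      have : ENNReal.ofReal ‖(1 / 2 : ℂ)‖ = 2⁻¹ := by
        simp [ENNReal.ofReal_inv_of_pos]
      rw [this]
      refine pow_le_of_le_one zero_le ?_ (by norm_num)
      exact pow_le_one₀ zero_le (by simp)
  refine ne_top_of_le_ne_top ?_ h
  rw [ENNReal.tsum_geometric]
  simp

/-- For each `n`, a group carrying a first letter map has a multiplier with a decomposition of
length `n + 1` that takes large values, with the phases of a Fourier matrix, on the positive words
of length `n + 2`. -/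
theorem exists_multiplier {G : Type u} [Group G] (F : FirstLetter G Letter) (n : ℕ) :
    ∃ φ : G → ℂ, (∃ C : ℝ, ∀ t, ‖φ t‖ ≤ C) ∧ Nonempty (Decomposition (n + 1) φ) ∧
      ∀ (k : ℕ) (t : Fin (n + 2) → ZMod (64 ^ k)),
        φ (List.ofFn fun i => F.gen ⟨k, t i⟩).prod =
          (((1 / 4) ^ k * ((1 / 8) ^ k) ^ n * (1 / 2) ^ (n + 2) : ℝ) : ℂ) *
            wordWeight (fun i j => ZMod.stdAddChar (i * j)) (List.ofFn t) 0 := by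
  have hc := norm_fourierWeight_le
  have hs := blockScale_levelIndex
  choose R hR hRn using fun t : G => exists_clm_of_energy_le
    (FirstLetter.scale blockScale ∘ₗ F.rep fourierWeight blockBase t) 18
    (fun h => by
      simpa using F.energy_scale_rep_le fourierWeight blockBase hc blockScale norm_blockScale_le
        tsum_blockScale_mul_fourierWeight_le t h)
  obtain ⟨S, hS, -⟩ := exists_clm_of_energy_le
    (FirstLetter.scale (G := G) blockScale) 1
    (fun h => by simpa using FirstLetter.energy_scale_le blockScale norm_blockScale_le h)
  choose e he hen using F.exists_evalResolvent fourierWeight blockBase hc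
  have hgeo : Summable fun k : ℕ => ((1 : ℝ) / 2) ^ k * 2 := summable_geometric_two.mul_right 2
  -- Starting from level n + 2 singles out words of length n + 2, and the starting index (k, 0) sees
  -- only block k; the factor 2^(-k) makes the sum over blocks converge.
  let E : G → ℕ → (lp (fun _ : G × ℕ × Letter => ℂ) 2 →L[ℂ] ℂ) := fun t k =>
    ((1 / 2 : ℂ) ^ k) • e (t, n + 2, ⟨k, 0⟩)
  have hE : ∀ t k, ‖E t k‖ ≤ (1 / 2 : ℝ) ^ k * 2 := by
    intro t k
    simp only [E, norm_smul, norm_pow]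
    have : ‖(1 / 2 : ℂ)‖ = 1 / 2 := by simp
    rw [this]
    gcongr
    exact hen _
  have hEs : ∀ t, Summable (E t) := fun t => Summable.of_norm_bounded hgeo (hE t)
  let f : G → (lp (fun _ : G × ℕ × Letter => ℂ) 2 →L[ℂ] ℂ) := fun t => ∑' k, E t k
  have hf : ∀ t h, f t h = ∑' k : ℕ, (1 / 2 : ℂ) ^ k *
      F.resolvent fourierWeight blockBase (h : G × ℕ × Letter → ℂ) (t, n + 2, ⟨k, 0⟩) := by
    intro t h
    have := (ContinuousLinearMap.apply ℂ ℂ h).map_tsum (hEs t)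
    simp only [ContinuousLinearMap.apply_apply] at this
    rw [this]
    simp only [E, smul_apply, he, smul_eq_mul]
  have hfn : ∀ t, ‖f t‖ ≤ ∑' k : ℕ, (1 / 2 : ℝ) ^ k * 2 := fun t =>
    tsum_of_norm_bounded hgeo.hasSum (hE t)
  let w : lp (fun _ : G × ℕ × Letter => ℂ) 2 := ⟨baseFun G, memℓp_baseFun G⟩
  have hw : w ≠ 0 := by
    intro h
    have h1 : (w : G × ℕ × Letter → ℂ) (1, 0, ⟨0, 0⟩) = 0 := by rw [h]; rfl
    have h2 : (w : G × ℕ × Letter → ℂ) (1, 0, ⟨0, 0⟩) = 1 := by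
      have := baseFun_base (G := G) 0
      simpa using this
    rw [h2] at h1
    exact one_ne_zero h1
  have hSn : ∀ m p, ((S ^ m) w : G × ℕ × Letter → ℂ) p = blockScale p.2.2 ^ m * baseFun G p := by
    intro m p
    induction m with
    | zero => simp [w]
    | succ m ih =>
      rw [pow_succ', mul_apply_eq_comp, hS, FirstLetter.scale_apply, ih, pow_succ']
      ring
  refine ⟨fun t => f t ((S ^ n) w), ⟨(∑' k : ℕ, (1 / 2 : ℝ) ^ k * 2) * ‖(S ^ n) w‖, fun t =>
    ((f t).le_opNorm _).trans (mul_le_mul_of_nonneg_right (hfn t) (norm_nonneg _))⟩, ?_, ?_⟩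
  · refine nonempty_decomposition_of_scaled_rep n _ w hw f R S _ (Real.sqrt (18 : NNReal)) hfn hRn
      ?_ ?_ (fun t => rfl)
    · intro x y h
      rw [hf, hf]
      congr 1
      funext k
      rw [hR, hS]
      simp only [LinearMap.comp_apply]
      -- The resolvent turns the conjugated translation by y into right translation, which moves the
      -- evaluation point from x to xy.
      rw [F.resolvent_scale hs, F.resolvent_scale hs, F.resolvent_rep]
      rfl
    · intro t h
      apply lp.ext
      rw [hS, hR, hR, hS]
      simp only [LinearMap.comp_apply]
      rw [F.rep_scale hs]
  · intro k t
    have hw0 : ∀ x l q, ((S ^ n) w : G × ℕ × Letter → ℂ) (x, l + 1, q) = 0 := by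
      intro x l q
      rw [hSn, baseFun_succ, mul_zero]
    let L : List Letter := List.ofFn fun i => ⟨k, t i⟩
    have hprod : (List.ofFn fun i => F.gen ⟨k, t i⟩).prod = (L.map F.gen).prod := by
      simp only [L, List.map_ofFn]
      rfl
    have hlen : L.length = n + 2 := by simp [L]
    have hL : L ≠ [] := by
      intro h
      rw [h] at hlen
      simp at hlen
    have hval : ∀ q, F.resolvent fourierWeight blockBase ((S ^ n) w : G × ℕ × Letter → ℂ)
        ((L.map F.gen).prod, n + 2, q) = wordWeight fourierWeight L q *
          (((8 : ℂ) ^ k)⁻¹ ^ n * (1 / 2) ^ k) := by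
      intro q
      have h1 := F.resolvent_list_prod fourierWeight blockBase ((S ^ n) w) hw0 ⟨k, 0⟩ L hL
        (by
          intro i hi
          simp only [L, List.mem_ofFn] at hi
          obtain ⟨j, rfl⟩ := hi
          rfl) q
      rw [hlen] at h1
      rw [h1, hSn, baseFun_base]
      rfl
    have hoff : ∀ k', k' ≠ k → wordWeight fourierWeight L ⟨k', 0⟩ = 0 := by
      intro k' hk'
      simp only [L, List.ofFn_succ, wordWeight]
      rw [fourierWeight_of_ne (by exact Ne.symm hk'), zero_mul]
    have hon : ∀ (M : List (ZMod (64 ^ k))) (j : ZMod (64 ^ k)),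
        wordWeight fourierWeight (M.map fun i => (⟨k, i⟩ : Letter)) ⟨k, j⟩ =
          (1 / 2) ^ M.length * wordWeight (fun i j => ZMod.stdAddChar (i * j)) M j := by
      intro M
      induction M with
      | nil => simp [wordWeight]
      | cons i M ih =>
        intro j
        rw [List.map_cons, wordWeight, ih, fourierWeight_block, wordWeight, List.length_cons]
        ring
    beta_reduce
    rw [hprod, hf, tsum_eq_single k]
    · rw [hval]
      have hLm : L = (List.ofFn t).map fun i => (⟨k, i⟩ : Letter) := by
        simp only [L, List.map_ofFn]
        rfl
      rw [hLm, hon, List.length_ofFn]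
      push_cast
      -- One factor 2^(-k) comes from the functional, the other from `baseFun`.
      have h4 : (1 / 4 : ℂ) ^ k = (1 / 2) ^ k * (1 / 2) ^ k := by
        rw [← mul_pow]; norm_num
      rw [h4, one_div_pow (8 : ℂ), one_div ((8 : ℂ) ^ k)]
      ring
    · intro k' hk'
      rw [hval, hoff k' hk']
      simp

end MdMultiplier

/-! ### Comparison of the two estimates -/

theorem proposition1p4 {G : Type u} [Group G] [TopologicalSpace G] [DiscreteTopology G]
    (hG : ∃ F : Subgroup G, IsFreeGroup F ∧ ∃ a b : F, a * b ≠ b * a)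
    (d : ℕ) (hd : 2 ≤ d) :
    MdMultipliers G (d + 1) ⊂ MdMultipliers G d := by
  obtain ⟨n, rfl⟩ : ∃ n, d = n + 1 := ⟨d - 1, by omega⟩
  rw [Set.ssubset_iff_of_subset]
  · obtain ⟨F⟩ := FirstLetter.nonempty_of_free_subgroup hG MdMultiplier.Letter
    obtain ⟨φ, ⟨C, hC⟩, hφ, hval⟩ := MdMultiplier.exists_multiplier F n
    refine ⟨BoundedContinuousFunction.ofNormedAddCommGroupDiscrete φ C hC, hφ, ?_⟩
    rintro ⟨D⟩
    obtain ⟨B, hB⟩ := D.exists_bound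
    -- With N = 64^k and r² = 16^(-k) N^(-n) 4^(-(n+2)), the bound r² N^(n+2) ≤ BN reduces to this,
    -- since 64/16 = 4.
    have key : ∀ k : ℕ, (4 : ℝ) ^ k ≤ B * 4 ^ (n + 2) := by
      intro k
      have h := hB (64 ^ k) (fun i => F.gen ⟨k, i⟩)
        ((1 / 4) ^ k * ((1 / 8) ^ k) ^ n * (1 / 2) ^ (n + 2)) (fun t => hval k t)
      push_cast at h
      have h1 : ((1 / 8 : ℝ) ^ k) ^ 2 * 64 ^ k = 1 := by
        rw [← pow_mul, mul_comm k 2, pow_mul, ← mul_pow]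
        norm_num
      have h2 : ((1 / 4 : ℝ) ^ k) ^ 2 * 64 ^ k = 4 ^ k := by
        rw [← pow_mul, mul_comm k 2, pow_mul, ← mul_pow]
        norm_num
      have h3 : ((1 / 2 : ℝ) ^ (n + 2)) ^ 2 * 4 ^ (n + 2) = 1 := by
        rw [← pow_mul, mul_comm (n + 2) 2, pow_mul, ← mul_pow]
        norm_num
      have h4 : ((1 / 4 : ℝ) ^ k * ((1 / 8) ^ k) ^ n * (1 / 2) ^ (n + 2)) ^ 2 *
          (64 ^ k) ^ (n + 2) * 4 ^ (n + 2) = 4 ^ k * 64 ^ k := by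
        calc _ = (((1 / 4 : ℝ) ^ k) ^ 2 * 64 ^ k) * (((1 / 8 : ℝ) ^ k) ^ 2 * 64 ^ k) ^ n *
              (((1 / 2 : ℝ) ^ (n + 2)) ^ 2 * 4 ^ (n + 2)) * 64 ^ k := by ring
          _ = _ := by rw [h1, h2, h3]; ring
      have h5 : (4 : ℝ) ^ k * 64 ^ k ≤ B * 4 ^ (n + 2) * 64 ^ k := by
        rw [← h4]
        calc _ ≤ B * 64 ^ k * 4 ^ (n + 2) := by gcongr
          _ = _ := by ring
      exact le_of_mul_le_mul_right h5 (by positivity)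
    obtain ⟨k, hk⟩ := pow_unbounded_of_one_lt (B * 4 ^ (n + 2)) (by norm_num : (1 : ℝ) < 4)
    exact absurd (key k) (not_le.mpr hk)
  · rintro φ ⟨D⟩
    exact D.nonempty_pred
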